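/- Let $X=\{X_t\}_{t\in\mathbb R}$ and $B=\{B_t\}_{t\in\mathbb R}$ be two independent two-sided standard Brownian motions, and for integers $n\ge 0$ let $X^{(n)}_t = 2^{n/4}X_{t2^{-n/2}}$, $t\ge 0$. Let $G\sim\mathcal N(0,1)$ and let $\mathsf P:\mathbb R\to\mathbb R$ be a polynomial with centered Hermite rank $\ge 2$, i.e. $E[G\,\mathsf P(G)]=0$. Let $\alpha,\beta\in\mathbb R$, and let $\phi(i)=\alpha$ if $i$ is even and $\phi(i)=\beta$ if $i$ is odd. Fix an integer $N\ge 1$ and, for $j=1,\dots,N$, set $$M_j^{(n)}=2^{-n/4}\sum_{i=\lfloor (j-1)2^{n/2}\rfloor+1}^{\lfloor j2^{n/2}\rfloor}\phi(i)\left\{\mathsf P\big(X_i^{(n)}-X_{i-1}^{(n)}\big)-E[\mathsf P(G)]\right\},$$ $$M_{j+N}^{(n)}=2^{-n/4}\sum_{i=\lfloor (j-1)2^{n/2}\rfloor+1}^{\lfloor j2^{n/2}\rfloor}(-1)^i\big(X_i^{(n)}-X_{i-1}^{(n)}\big).$$ Then, as $n\to\infty$, the random element $\big(M_1^{(n)},\dots,M_{2N}^{(n)};\{X_t\}_{t\ge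 0}\big)$ converges weakly in $\mathbb R^{2N}\times C^0(\mathbb R_+)$ (with uniform convergence on compact sets on $C^0(\mathbb R_+)$) to $$\left(\sqrt{\tfrac{\alpha^2+\beta^2}{2}\,\mathrm{Var}\big(\mathsf P(G)\big)}\,\big(\Delta B(1),\dots,\Delta B(N)\big);\ \Delta B(N+1),\dots,\Delta B(2N);\ \{X_t\}_{t\ge 0}\right),$$ where $\Delta B(i)=B_i-B_{i-1}$ for $i=1,\dots,2N$. -/

import Mathlib

open MeasureTheory ProbabilityTheory Filter
open scoped NNReal

noncomputable section

/-- The space of continuous functions from `[0, ∞)` to `ℝ`, with its topology of uniform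
convergence on compact sets, carries the Borel σ-algebra. -/
instance instMeasurableSpaceContPath : MeasurableSpace C(ℝ≥0, ℝ) := borel _

instance instBorelSpaceContPath : BorelSpace C(ℝ≥0, ℝ) := ⟨rfl⟩

/-- A two-sided Brownian motion: `(X_t)_{t ≥ 0}` and `(X_{-t})_{t ≥ 0}` are two independent
standard Brownian motions (with almost surely continuous paths). -/
structure IsTwoSidedBrownianMotion {Ω : Type*} [MeasurableSpace Ω] (X : ℝ → Ω → ℝ)
    (μ : Measure Ω) : Prop where
  right : IsBrownianReal (fun t : ℝ≥0 ↦ X (t : ℝ)) μ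
  left : IsBrownianReal (fun t : ℝ≥0 ↦ X (-(t : ℝ))) μ
  indep : IndepFun (fun ω (t : ℝ≥0) ↦ X (t : ℝ) ω) (fun ω (t : ℝ≥0) ↦ X (-(t : ℝ)) ω) μ

/-- The path `{X_t}_{t ≥ 0}`, as an element of `C(ℝ≥0, ℝ)` (and `0` on the null event where
the path is not continuous). -/
def rightPath {Ω : Type*} (X : ℝ → Ω → ℝ) (ω : Ω) : C(ℝ≥0, ℝ) :=
  ContinuousMap.mkD (fun t : ℝ≥0 ↦ X (t : ℝ) ω) 0

/-- The rescaled process `X^{(n)}_t = 2^{n/4} X_{t 2^{-n/2}}`. -/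
def rescaledProcess {Ω : Type*} (X : ℝ → Ω → ℝ) (n : ℕ) (t : ℝ) (ω : Ω) : ℝ :=
  (2 : ℝ) ^ ((n : ℝ) / 4) * X (t * (2 : ℝ) ^ (-((n : ℝ) / 2))) ω

/-- The increment `X^{(n)}_i - X^{(n)}_{i-1}`. -/
def rescaledIncrement {Ω : Type*} (X : ℝ → Ω → ℝ) (n i : ℕ) (ω : Ω) : ℝ :=
  rescaledProcess X n (i : ℝ) ω - rescaledProcess X n ((i : ℝ) - 1) ω

/-- `E[p(G)]`, where `G` is a standard Gaussian random variable. -/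
def gaussianMean (p : Polynomial ℝ) : ℝ := ∫ x, p.eval x ∂(gaussianReal 0 1)

/-- `Var(p(G))`, where `G` is a standard Gaussian random variable. -/
def gaussianVar (p : Polynomial ℝ) : ℝ := Var[fun x ↦ p.eval x; gaussianReal 0 1]

/-- `p` has centered Hermite rank at least `2`: `E[G p(G)] = 0`, where `G` is a standard
Gaussian random variable. -/
def CenteredHermiteRankGeTwo (p : Polynomial ℝ) : Prop :=
  ∫ x, x * p.eval x ∂(gaussianReal 0 1) = 0

/-- `φ(i)` equals `α` if `i` is even and `β` if `i` is odd. -/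
def parityWeight (α β : ℝ) (i : ℕ) : ℝ := if Even i then α else β

/-- The indices `i` of the `j`-th block:
`⌊(j - 1) 2^{n/2}⌋ + 1 ≤ i ≤ ⌊j 2^{n/2}⌋`, for `j ≥ 1`. -/
def blockIndices (n j : ℕ) : Finset ℕ :=
  Finset.Icc (⌊((j : ℝ) - 1) * (2 : ℝ) ^ ((n : ℝ) / 2)⌋₊ + 1) ⌊(j : ℝ) * (2 : ℝ) ^ ((n : ℝ) / 2)⌋₊

/-- `2^{-n/4} ∑_i φ(i) (p(X^{(n)}_i - X^{(n)}_{i-1}) - E[p(G)])` over the `j`-th block. -/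
def polyBlockSum {Ω : Type*} (X : ℝ → Ω → ℝ) (p : Polynomial ℝ) (α β : ℝ) (n j : ℕ) (ω : Ω) : ℝ :=
  (2 : ℝ) ^ (-((n : ℝ) / 4)) *
    ∑ i ∈ blockIndices n j,
      parityWeight α β i * (p.eval (rescaledIncrement X n i ω) - gaussianMean p)

/-- `2^{-n/4} ∑_i (-1)^i (X^{(n)}_i - X^{(n)}_{i-1})` over the `j`-th block. -/
def signedBlockSum {Ω : Type*} (X : ℝ → Ω → ℝ) (n j : ℕ) (ω : Ω) : ℝ :=
  (2 : ℝ) ^ (-((n : ℝ) / 4)) *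
    ∑ i ∈ blockIndices n j, (-1 : ℝ) ^ i * rescaledIncrement X n i ω

/-- The vector `(M_1^{(n)}, …, M_{2N}^{(n)})`. -/
def blockVector {Ω : Type*} (X : ℝ → Ω → ℝ) (p : Polynomial ℝ) (α β : ℝ) (N n : ℕ) (ω : Ω) :
    Fin (N + N) → ℝ :=
  Fin.append (fun j : Fin N ↦ polyBlockSum X p α β n (j + 1) ω)
    (fun j : Fin N ↦ signedBlockSum X n (j + 1) ω)

/-- The unit increment `ΔB(i) = B_i - B_{i-1}`. -/
def unitIncrement {Ω : Type*} (B : ℝ → Ω → ℝ) (i : ℕ) (ω : Ω) : ℝ :=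
  B (i : ℝ) ω - B ((i : ℝ) - 1) ω

/-- The vector `(σ ΔB(1), …, σ ΔB(N), ΔB(N+1), …, ΔB(2N))` with
`σ = √((α² + β²)/2 · Var(p(G)))`. -/
def limitVector {Ω : Type*} (B : ℝ → Ω → ℝ) (p : Polynomial ℝ) (α β : ℝ) (N : ℕ) (ω : Ω) :
    Fin (N + N) → ℝ :=
  Fin.append
    (fun j : Fin N ↦ √((α ^ 2 + β ^ 2) / 2 * gaussianVar p) * unitIncrement B (j + 1) ω)
    (fun j : Fin N ↦ unitIncrement B (N + j + 1) ω)

end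

open scoped ENNReal Topology

/-! ### The Borel σ-algebra of the path space -/

/-! By Brownian scaling, the increments at level `n` are i.i.d. standard Gaussians `ξ_m`. A linear
combination of the block sums and of finitely many values of `X` at grid points is `2^{-n/4} ∑
f_θ(ξ_m)`, where `θ` ranges over a finite set recording parity, block and the times still ahead
(`gridScale_mul_sum_rowFun`). Each `f_θ` is centered, so the characteristic function of the sum is
asymptotically the Gaussian one with the same variance (`tendsto_integral_cexp_rowSum_sub`).

In that variance the Hermite rank condition removes the cross terms between `p(ξ)` and `ξ`. The
cross terms between the signed sums and the values of `X` carry the sign `(-1)^i` and average out.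
What remains is the variance of the block sums plus that of the values of `X`, so the characteristic
function factors in the limit (`tendsto_integral_cexp_gridCombination`). Lévy's continuity theorem
then gives joint convergence with finitely many values of `X`.

No tightness argument is needed for the path, since it does not depend on `n`. Evaluations generate
the Borel σ-algebra of `C(ℝ≥0, ℝ)`, so a π-λ argument extends the convergence to every event of the
path, and approximating the path by simple functions gives joint weak convergence
(`tendstoInDistribution_prodMk_contPath`). -/

/-- If the compact set `f(K)` lies in `U`, it stays at positive distance from `Uᶜ`. So membership
can be tested on a countable dense subset of `K`, with a margin `1/(m+1)` that survives passing to
the closure. -/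
lemma measurableSet_mapsTo_comap_eval {K : Set ℝ≥0} (hK : IsCompact K) {U : Set ℝ}
    (hU : IsOpen U) :
    MeasurableSet[MeasurableSpace.comap (fun (f : C(ℝ≥0, ℝ)) (t : ℝ≥0) ↦ f t)
      MeasurableSpace.pi] {f : C(ℝ≥0, ℝ) | Set.MapsTo f K U} := by
  obtain ⟨D, hDK, hD, hKD⟩ :=
    (TopologicalSpace.IsSeparable.of_separableSpace K).exists_countable_dense_subset
  let V : ℕ → Set ℝ := fun m ↦ {y | ((m : ℝ≥0∞) + 1)⁻¹ ≤ Metric.infEDist y Uᶜ}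
  have hV m : IsClosed (V m) := isClosed_le continuous_const Metric.continuous_infEDist
  refine ⟨⋃ m, ⋂ x ∈ D, (fun g : ℝ≥0 → ℝ ↦ g x) ⁻¹' V m, .iUnion fun m ↦ .biInter hD fun x _ ↦
    measurable_pi_apply x (hV m).measurableSet, ?_⟩
  ext f
  simp only [Set.mem_preimage, Set.mem_iUnion, Set.mem_iInter, Set.mem_ofPred_eq]
  refine ⟨fun ⟨m, hm⟩ x hx ↦ ?_, fun h ↦ ?_⟩
  · have : f x ∈ V m := by
      have h1 : closure D ⊆ f ⁻¹' V m := closure_minimal hm ((hV m).preimage f.continuous)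
      exact h1 (hKD hx)
    by_contra hxU
    have h0 : Metric.infEDist (f x) Uᶜ = 0 := Metric.infEDist_zero_of_mem hxU
    simp only [V, Set.mem_ofPred_eq, h0, nonpos_iff_eq_zero, ENNReal.inv_eq_zero] at this
    simp at this
  · obtain ⟨δ, hδ, hsub⟩ := (hK.image f.continuous).exists_cthickening_subset_open hU
      (Set.image_subset_iff.2 h)
    obtain ⟨m, hm⟩ := exists_nat_one_div_lt hδ
    refine ⟨m, fun x hx ↦ Metric.le_infEDist.2 fun y hy ↦ ?_⟩
    by_contra! hlt
    refine hy (hsub ?_)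
    refine Metric.mem_cthickening_of_edist_le y (f x) δ _ (Set.mem_image_of_mem _ (hDK hx)) ?_
    rw [edist_comm]
    refine hlt.le.trans ?_
    rw [← ENNReal.ofReal_natCast, ← ENNReal.ofReal_one, ← ENNReal.ofReal_add (by positivity)
      zero_le_one, ← ENNReal.ofReal_inv_of_pos (by positivity)]
    exact ENNReal.ofReal_le_ofReal (by simpa using hm.le)

lemma borel_contPath_eq_comap_eval :
    instMeasurableSpaceContPath =
      MeasurableSpace.comap (fun (f : C(ℝ≥0, ℝ)) (t : ℝ≥0) ↦ f t) MeasurableSpace.pi := by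
  refine le_antisymm ?_ ?_
  · have h : instMeasurableSpaceContPath = borel C(ℝ≥0, ℝ) := rfl
    rw [h, borel_eq_generateFrom_of_subbasis ContinuousMap.compactOpen_eq]
    refine MeasurableSpace.generateFrom_le ?_
    rintro _ ⟨K, hK, U, hU, rfl⟩
    exact measurableSet_mapsTo_comap_eval hK hU
  · rw [← measurable_iff_comap_le]
    exact measurable_pi_lambda _ fun t ↦ (continuous_eval_const (F := C(ℝ≥0, ℝ)) t).measurable

lemma contPath_eq_generateFrom_cylinders :
    instMeasurableSpaceContPath = MeasurableSpace.generateFrom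
      {s | ∃ t ∈ measurableCylinders fun _ : ℝ≥0 ↦ ℝ,
        (fun (f : C(ℝ≥0, ℝ)) (t : ℝ≥0) ↦ f t) ⁻¹' t = s} := by
  rw [borel_contPath_eq_comap_eval, ← generateFrom_measurableCylinders,
    MeasurableSpace.comap_generateFrom]
  rfl

lemma measurable_eval_contPath (t : ℝ≥0) : Measurable fun f : C(ℝ≥0, ℝ) ↦ f t :=
  (continuous_eval_const (F := C(ℝ≥0, ℝ)) t).measurable

lemma measurable_contPath_iff {Ω : Type*} [MeasurableSpace Ω] {W : Ω → C(ℝ≥0, ℝ)} :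
    Measurable W ↔ ∀ t, Measurable fun ω ↦ W ω t := by
  refine ⟨fun h t ↦ (measurable_eval_contPath t).comp h, fun h ↦ ?_⟩
  rw [borel_contPath_eq_comap_eval, measurable_comap_iff]
  exact measurable_pi_lambda _ h

lemma measurable_contPath_of_dense {Ω : Type*} [MeasurableSpace Ω] {W : Ω → C(ℝ≥0, ℝ)}
    {D : Set ℝ≥0} (hD : Dense D) (h : ∀ t ∈ D, Measurable fun ω ↦ W ω t) : Measurable W := by
  refine measurable_contPath_iff.2 fun t ↦ ?_
  obtain ⟨u, huD, hu⟩ := mem_closure_iff_seq_limit.1 (hD t)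
  refine measurable_of_tendsto_metrizable (fun i ↦ h (u i) (huD i)) ?_
  exact tendsto_pi_nhds.2 fun ω ↦ ((W ω).continuous.tendsto t).comp hu

/-- Continuity reduces uncountably many exceptional null sets to those of a countable dense set of
times; the path is set to `0` on a measurable null set containing them. -/
lemma aemeasurable_contPath {Ω : Type*} [MeasurableSpace Ω] {μ : Measure Ω} {W : Ω → C(ℝ≥0, ℝ)}
    (h : ∀ t, AEMeasurable (fun ω ↦ W ω t) μ) : AEMeasurable W μ := by
  obtain ⟨D, hDc, hD⟩ := TopologicalSpace.exists_countable_dense ℝ≥0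
  have hae : ∀ᵐ ω ∂μ, ∀ t ∈ D, W ω t = (h t).mk _ ω :=
    (ae_ball_iff hDc).2 fun t _ ↦ (h t).ae_eq_mk
  obtain ⟨S, hS, hSm, hS0⟩ := exists_measurable_superset_of_null hae
  classical
  refine ⟨fun ω ↦ if ω ∈ S then 0 else W ω, measurable_contPath_of_dense hD fun t ht ↦ ?_, ?_⟩
  · have : (fun ω ↦ (if ω ∈ S then (0 : C(ℝ≥0, ℝ)) else W ω) t) =
        fun ω ↦ if ω ∈ S then 0 else (h t).mk _ ω := by
      ext ω
      split_ifs with hω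
      · rfl
      · by_contra hne
        exact hω (hS fun h' ↦ hne (h' t ht))
    rw [this]
    exact Measurable.ite hSm measurable_const (h t).measurable_mk
  · filter_upwards [compl_mem_ae_iff.2 hS0] with ω hω
    rw [if_neg hω]

lemma ae_rightPath_apply {Ω : Type*} [MeasurableSpace Ω] {μ : Measure Ω} {X : ℝ → Ω → ℝ}
    (hX : ∀ᵐ ω ∂μ, Continuous fun t : ℝ≥0 ↦ X t ω) :
    ∀ᵐ ω ∂μ, ∀ t : ℝ≥0, rightPath X ω t = X t ω := by
  filter_upwards [hX] with ω hω t
  rw [rightPath, ContinuousMap.mkD_of_continuous hω]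
  rfl

lemma aemeasurable_rightPath {Ω : Type*} [MeasurableSpace Ω] {μ : Measure Ω} {X : ℝ → Ω → ℝ}
    (hX : IsBrownianReal (fun t : ℝ≥0 ↦ X t) μ) : AEMeasurable (rightPath X) μ := by
  refine aemeasurable_contPath fun t ↦ (hX.aemeasurable t).congr ?_
  filter_upwards [ae_rightPath_apply hX.cont] with ω hω using (hω t).symm

/-! ### Convergence of `(Y n, W)` in distribution for a fixed path-valued `W` -/

/-- Stability in `L¹` of the factor of a uniformly bounded sequence. -/
lemma tendsto_integral_mul_of_approx {Ω : Type*} [MeasurableSpace Ω] {μ : Measure Ω}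
    {a : ℕ → Ω → ℝ} {b : Ω → ℝ} {C : ℝ} (ha : ∀ n, AEStronglyMeasurable (a n) μ)
    (hb : AEStronglyMeasurable b μ) (haC : ∀ n ω, ‖a n ω‖ ≤ C) (hbC : ∀ ω, ‖b ω‖ ≤ C)
    {h : Ω → ℝ} (hh : Integrable h μ)
    (happ : ∀ ε > 0, ∃ k : Ω → ℝ, Integrable k μ ∧ ∫ ω, ‖h ω - k ω‖ ∂μ ≤ ε ∧
      Tendsto (fun n ↦ ∫ ω, a n ω * k ω ∂μ) atTop (𝓝 (∫ ω, b ω * k ω ∂μ))) :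
    Tendsto (fun n ↦ ∫ ω, a n ω * h ω ∂μ) atTop (𝓝 (∫ ω, b ω * h ω ∂μ)) := by
  have key {c : Ω → ℝ} (hc : AEStronglyMeasurable c μ) (hcC : ∀ ω, ‖c ω‖ ≤ C) {k : Ω → ℝ}
      (hk : Integrable k μ) :
      |∫ ω, c ω * h ω ∂μ - ∫ ω, c ω * k ω ∂μ| ≤ C * ∫ ω, ‖h ω - k ω‖ ∂μ := by
    rw [← integral_sub (hh.bdd_mul hc (.of_forall hcC)) (hk.bdd_mul hc (.of_forall hcC)),
      ← integral_const_mul, ← Real.norm_eq_abs]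
    refine norm_integral_le_of_norm_le ((hh.sub hk).norm.const_mul C) (.of_forall fun ω ↦ ?_)
    rw [← mul_sub, norm_mul]
    exact mul_le_mul_of_nonneg_right (hcC ω) (norm_nonneg _)
  rw [Metric.tendsto_atTop]
  intro ε hε
  obtain ⟨k, hk, hkε, hkt⟩ := happ (ε / (4 * (|C| + 1))) (by positivity)
  obtain ⟨n₀, hn₀⟩ := Metric.tendsto_atTop.1 hkt (ε / 2) (by positivity)
  have hsmall : C * ∫ ω, ‖h ω - k ω‖ ∂μ ≤ ε / 4 := by
    have h0 : 0 ≤ ∫ ω, ‖h ω - k ω‖ ∂μ := integral_nonneg fun _ ↦ norm_nonneg _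
    calc C * ∫ ω, ‖h ω - k ω‖ ∂μ ≤ (|C| + 1) * (ε / (4 * (|C| + 1))) :=
          mul_le_mul ((le_abs_self C).trans (by linarith)) hkε h0 (by positivity)
      _ = ε / 4 := by field_simp
  refine ⟨n₀, fun n hn ↦ ?_⟩
  have h1 := key (ha n) (haC n) hk
  have h2 := key hb hbC hk
  have h3 := hn₀ n hn
  rw [Real.dist_eq, abs_lt] at *
  rw [abs_le] at h1 h2
  constructor <;> linarith [h1.1, h1.2, h2.1, h2.2, h3.1, h3.2]

/-- Induction over the π-system of cylinders. The uniform bound on `a n` allows the indicator of the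
event to be replaced by an `L¹`-close function: a bounded continuous one for cylinders, a finite
partial union for countable disjoint unions. -/
lemma tendsto_setIntegral_preimage_contPath {Ω : Type*} [MeasurableSpace Ω] {μ : Measure Ω}
    [IsProbabilityMeasure μ] {a : ℕ → Ω → ℝ} {b : Ω → ℝ} {C : ℝ}
    (ha : ∀ n, AEStronglyMeasurable (a n) μ)
    (hb : AEStronglyMeasurable b μ) (haC : ∀ n ω, ‖a n ω‖ ≤ C) (hbC : ∀ ω, ‖b ω‖ ≤ C)
    {W : Ω → C(ℝ≥0, ℝ)} (hW : Measurable W)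
    (hfd : ∀ (I : Finset ℝ≥0) (g : BoundedContinuousFunction (I → ℝ) ℝ),
      Tendsto (fun n ↦ ∫ ω, a n ω * g (fun t ↦ W ω t) ∂μ) atTop
        (𝓝 (∫ ω, b ω * g (fun t ↦ W ω t) ∂μ)))
    {B : Set C(ℝ≥0, ℝ)} (hB : MeasurableSet B) :
    Tendsto (fun n ↦ ∫ ω in W ⁻¹' B, a n ω ∂μ) atTop (𝓝 (∫ ω in W ⁻¹' B, b ω ∂μ)) := by
  have hai n : Integrable (a n) μ := .of_bound (ha n) C (.of_forall (haC n))
  have hbi : Integrable b μ := .of_bound hb C (.of_forall hbC)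
  have hind (B : Set C(ℝ≥0, ℝ)) (hB : MeasurableSet B) (c : Ω → ℝ) :
      ∫ ω in W ⁻¹' B, c ω ∂μ = ∫ ω, c ω * (W ⁻¹' B).indicator 1 ω ∂μ := by
    rw [← integral_indicator (hW hB)]
    congr with ω
    by_cases h : ω ∈ W ⁻¹' B <;> simp [h]
  induction B, hB using MeasurableSpace.induction_on_inter
    contPath_eq_generateFrom_cylinders (isPiSystem_measurableCylinders.comap _) with
  | empty => simp
  | basic s hs =>
    obtain ⟨_, ht, rfl⟩ := hs
    obtain ⟨I, S, hS, rfl⟩ := (mem_measurableCylinders _).1 ht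
    set B : Set C(ℝ≥0, ℝ) := (fun f t ↦ f t) ⁻¹' cylinder I S
    let r : Ω → I → ℝ := fun ω t ↦ W ω t
    have hr : Measurable r := measurable_pi_lambda _ fun t ↦ measurable_contPath_iff.1 hW t
    have hBm : MeasurableSet B := by
      have h1 : Measurable fun f : C(ℝ≥0, ℝ) ↦ fun t : I ↦ f (t : ℝ≥0) :=
        measurable_pi_lambda _ fun t ↦ measurable_eval_contPath t
      exact h1 hS
    simp_rw [hind B hBm]
    refine tendsto_integral_mul_of_approx ha hb haC hbC
      ((integrable_const (1 : ℝ)).indicator (hW hBm)) fun ε hε ↦ ?_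
    have : IsProbabilityMeasure (μ.map r) := Measure.isProbabilityMeasure_map hr.aemeasurable
    obtain ⟨g, hg, hgi⟩ := ((integrable_const (μ := μ.map r) (1 : ℝ)).indicator
      hS).exists_boundedContinuous_integral_sub_le hε
    refine ⟨fun ω ↦ g (r ω), hgi.comp_measurable hr, ?_, hfd I g⟩
    rw [integral_map hr.aemeasurable] at hg
    · exact hg
    · exact (((measurable_const.indicator hS).sub g.continuous.measurable).norm).aestronglyMeasurable
  | compl s hs ih =>
    have h1 (c : Ω → ℝ) (hc : Integrable c μ) :
        ∫ ω in W ⁻¹' sᶜ, c ω ∂μ = ∫ ω, c ω ∂μ - ∫ ω in W ⁻¹' s, c ω ∂μ := by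
      rw [Set.preimage_compl, setIntegral_compl (hW hs) hc]
    simp_rw [h1 _ (hai _), h1 _ hbi]
    refine Tendsto.sub ?_ ih
    -- Convergence of the total integrals is the case of no times and `g = 1`.
    simpa using hfd ∅ (BoundedContinuousFunction.const _ 1)
  | iUnion f hd hf ih =>
    have hUm : MeasurableSet (⋃ i, f i) := .iUnion hf
    let A : ℕ → Set Ω := fun m ↦ ⋃ i ∈ Finset.range m, W ⁻¹' f i
    have hAm m : MeasurableSet (A m) :=
      .biUnion (Finset.range m).countable_toSet fun i _ ↦ hW (hf i)
    have hAsub m : A m ⊆ W ⁻¹' ⋃ i, f i := by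
      rw [Set.preimage_iUnion]
      exact Set.iUnion₂_subset fun i _ ↦ Set.subset_iUnion (fun i ↦ W ⁻¹' f i) i
    have hAU : ⋃ m, A m = W ⁻¹' ⋃ i, f i := by
      refine (Set.iUnion_subset hAsub).antisymm ?_
      rw [Set.preimage_iUnion]
      exact Set.iUnion_subset fun i ↦ Set.subset_iUnion_of_subset (i + 1)
        (Set.subset_biUnion_of_mem (u := fun i ↦ W ⁻¹' f i) (by simp))
    have hlim := tendsto_setIntegral_of_monotone (f := fun _ ↦ (1 : ℝ)) (μ := μ) hAm
      (fun m m' hmm ↦ Set.biUnion_subset_biUnion_left (by simpa using hmm))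
      (integrable_const _).integrableOn
    rw [hAU] at hlim
    simp_rw [hind _ hUm]
    refine tendsto_integral_mul_of_approx ha hb haC hbC
      ((integrable_const (1 : ℝ)).indicator (hW hUm)) fun ε hε ↦ ?_
    obtain ⟨m, hm⟩ := (Metric.tendsto_atTop.1 hlim) ε hε
    have hmul (c : Ω → ℝ) (hc : Integrable c μ) :
        ∫ ω, c ω * (A m).indicator 1 ω ∂μ = ∑ i ∈ Finset.range m, ∫ ω in W ⁻¹' f i, c ω ∂μ := by
      rw [← integral_biUnion_finset _ (fun i _ ↦ hW (hf i))
        (fun i _ j _ hij ↦ (hd hij).preimage W) (fun i _ ↦ hc.integrableOn),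
        ← integral_indicator (hAm m)]
      congr with ω
      by_cases h : ω ∈ A m <;> simp [h]
    refine ⟨(A m).indicator 1, (integrable_const (1 : ℝ)).indicator (hAm m), ?_, ?_⟩
    · have h1 : ∀ ω, ‖(W ⁻¹' ⋃ i, f i).indicator (fun _ ↦ (1 : ℝ)) ω - (A m).indicator 1 ω‖ =
          (W ⁻¹' ⋃ i, f i).indicator (fun _ ↦ (1 : ℝ)) ω -
            (A m).indicator (fun _ ↦ (1 : ℝ)) ω := by
        intro ω
        rw [Real.norm_of_nonneg]
        · rfl
        · exact sub_nonneg.2 (Set.indicator_le_indicator_of_subset (hAsub m)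
            (fun _ ↦ zero_le_one) ω)
      simp_rw [Pi.one_def] at h1 ⊢
      simp_rw [h1]
      rw [integral_sub ((integrable_const (1 : ℝ)).indicator (hW hUm))
        ((integrable_const (1 : ℝ)).indicator (hAm m)), integral_indicator (hW hUm),
        integral_indicator (hAm m)]
      have := hm m le_rfl
      rw [Real.dist_eq, abs_lt] at this
      linarith [this.1]
    · simp_rw [hmul _ (hai _), hmul _ hbi]
      exact tendsto_finsetSum _ fun i _ ↦ ih i

/-- If `Y n → Z` in distribution on every event of the σ-algebra of `W`, then
`(Y n, W) → (Z, W)` in distribution. -/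
theorem tendsto_integral_prodMk_of_setIntegral {Ω E F : Type*} [MeasurableSpace Ω]
    {μ : Measure Ω} [IsProbabilityMeasure μ]
    [PseudoMetricSpace E] [MeasurableSpace E] [BorelSpace E] [SecondCountableTopology E]
    [PseudoMetricSpace F] [MeasurableSpace F] [BorelSpace F] [SecondCountableTopology F]
    {Y : ℕ → Ω → E} {Z : Ω → E} {W : Ω → F} (hY : ∀ n, AEMeasurable (Y n) μ)
    (hZ : AEMeasurable Z μ) (hW : Measurable W)
    (h : ∀ (f : BoundedContinuousFunction E ℝ) (B : Set F), MeasurableSet B →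
      Tendsto (fun n ↦ ∫ ω in W ⁻¹' B, f (Y n ω) ∂μ) atTop (𝓝 (∫ ω in W ⁻¹' B, f (Z ω) ∂μ)))
    {G : E × F → ℝ} {M : ℝ} (hM : ∀ x y, dist (G x) (G y) ≤ M) {L : ℝ≥0}
    (hL : LipschitzWith L G) :
    Tendsto (fun n ↦ ∫ ω, G (Y n ω, W ω) ∂μ) atTop (𝓝 (∫ ω, G (Z ω, W ω) ∂μ)) := by
  obtain ⟨ω₀⟩ : Nonempty Ω := nonempty_of_isProbabilityMeasure μ
  have hGm : Measurable G := hL.continuous.measurable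
  have hGb x : ‖G x‖ ≤ ‖G (Z ω₀, W ω₀)‖ + M := by
    have := norm_sub_norm_le (G x) (G (Z ω₀, W ω₀))
    have h2 := hM x (Z ω₀, W ω₀)
    rw [dist_eq_norm] at h2
    linarith
  -- Replacing `W` by `S k ∘ W` costs an error uniform in `n`, and on each fiber of `S k` the second
  -- argument of `G` is frozen, so `h` applies.
  let S : ℕ → SimpleFunc F F := SimpleFunc.approxOn id measurable_id Set.univ (W ω₀) trivial
  have hSW k : Measurable fun ω ↦ S k (W ω) := (S k).measurable.comp hW
  -- Truncation at the oscillation bound `M` of `G` makes the error integrable without any moment of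
  -- `W`.
  let δ : ℕ → Ω → ℝ := fun k ω ↦ min (L * dist (W ω) (S k (W ω))) M
  have hM0 : 0 ≤ M := dist_nonneg.trans (hM (Z ω₀, W ω₀) (Z ω₀, W ω₀))
  have hδ0 k ω : 0 ≤ δ k ω := le_min (by positivity) hM0
  have hδm k : Measurable (δ k) := ((hW.dist (hSW k)).const_mul _).min measurable_const
  have hδi k : Integrable (δ k) μ := .of_bound (hδm k).aestronglyMeasurable M
    (.of_forall fun ω ↦ by rw [Real.norm_of_nonneg (hδ0 k ω)]; exact min_le_right _ _)
  have hδ : Tendsto (fun k ↦ ∫ ω, δ k ω ∂μ) atTop (𝓝 0) := by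
    have : ∫ _, (0 : ℝ) ∂μ = 0 := integral_zero _ _
    rw [← this]
    refine tendsto_integral_of_dominated_convergence (fun _ ↦ M)
      (fun k ↦ (hδm k).aestronglyMeasurable) (integrable_const _)
      (fun k ↦ .of_forall fun ω ↦ by rw [Real.norm_of_nonneg (hδ0 k ω)]; exact min_le_right _ _)
      (.of_forall fun ω ↦ ?_)
    have h1 : Tendsto (fun k ↦ S k (W ω)) atTop (𝓝 (W ω)) :=
      SimpleFunc.tendsto_approxOn measurable_id (Set.mem_univ _) (by simp)
    have h2 := ((tendsto_const_nhds (x := W ω)).dist h1).const_mul (L : ℝ)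
    rw [dist_self, mul_zero] at h2
    simpa [hM0] using h2.min (tendsto_const_nhds (x := M))
  have hint {V : Ω → E} (hV : AEMeasurable V μ) {U : Ω → F} (hU : Measurable U) :
      Integrable (fun ω ↦ G (V ω, U ω)) μ :=
    .of_bound (hGm.comp_aemeasurable (hV.prodMk hU.aemeasurable)).aestronglyMeasurable _
      (.of_forall fun ω ↦ hGb _)
  have key {V : Ω → E} (hV : AEMeasurable V μ) k :
      |∫ ω, G (V ω, W ω) ∂μ - ∫ ω, G (V ω, S k (W ω)) ∂μ| ≤ ∫ ω, δ k ω ∂μ := by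
    rw [← integral_sub (hint hV hW) (hint hV (hSW k)), ← Real.norm_eq_abs]
    refine norm_integral_le_of_norm_le (hδi k) (.of_forall fun ω ↦ ?_)
    rw [← dist_eq_norm]
    refine le_min ((hL.dist_le_mul _ _).trans ?_) (hM _ _)
    gcongr
    simp [Prod.dist_eq]
  have hsum {V : Ω → E} (hV : AEMeasurable V μ) k : ∫ ω, G (V ω, S k (W ω)) ∂μ =
      ∑ x ∈ (S k).range, ∫ ω in W ⁻¹' (S k ⁻¹' {x}), G (V ω, x) ∂μ := by
    have hU : ⋃ x ∈ (S k).range, W ⁻¹' (S k ⁻¹' {x}) = Set.univ :=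
      Set.eq_univ_of_forall fun ω ↦ Set.mem_biUnion
        (Finset.mem_coe.2 ((S k).mem_range_self (W ω))) rfl
    rw [← setIntegral_univ, ← hU, integral_biUnion_finset _
      (fun x _ ↦ hW ((S k).measurableSet_fiber x)) _ (fun x _ ↦ (hint hV (hSW k)).integrableOn)]
    · refine Finset.sum_congr rfl fun x _ ↦ ?_
      refine setIntegral_congr_fun (hW ((S k).measurableSet_fiber x)) fun ω hω ↦ ?_
      have : S k (W ω) = x := hω
      simp only [this]
    · intro x _ y _ hxy
      exact ((Set.disjoint_singleton.2 hxy).preimage _).preimage _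
  have hlim k : Tendsto (fun n ↦ ∫ ω, G (Y n ω, S k (W ω)) ∂μ) atTop
      (𝓝 (∫ ω, G (Z ω, S k (W ω)) ∂μ)) := by
    simp_rw [hsum (hY _), hsum hZ]
    refine tendsto_finsetSum _ fun x _ ↦ ?_
    have hc : Continuous fun y : E ↦ G (y, x) := hL.continuous.comp (by fun_prop)
    exact h (.ofNormedAddCommGroup _ hc _ fun y ↦ hGb (y, x)) _ ((S k).measurableSet_fiber x)
  rw [Metric.tendsto_atTop]
  intro ε hε
  obtain ⟨k, hk⟩ := (hδ.eventually_lt_const (show 0 < ε / 4 by positivity)).exists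
  obtain ⟨n₀, hn₀⟩ := Metric.tendsto_atTop.1 (hlim k) (ε / 2) (by positivity)
  refine ⟨n₀, fun n hn ↦ ?_⟩
  have h1 := key (hY n) k
  have h2 := key hZ k
  have h3 := hn₀ n hn
  rw [Real.dist_eq, abs_lt] at *
  rw [abs_le] at h1 h2
  constructor <;> linarith [h1.1, h1.2, h2.1, h2.2, h3.1, h3.2]

/-- Convergence in distribution of `(Y n, W)` to `(Z, W)`, for a fixed random path `W`, follows
from the convergence with the finite-dimensional marginals of `W`. -/
theorem tendstoInDistribution_prodMk_contPath {Ω E : Type*} [MeasurableSpace Ω]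
    {μ : Measure Ω} [IsProbabilityMeasure μ]
    [PseudoMetricSpace E] [MeasurableSpace E] [BorelSpace E] [SecondCountableTopology E]
    {Y : ℕ → Ω → E} {Z : Ω → E} {W : Ω → C(ℝ≥0, ℝ)} (hY : ∀ n, AEMeasurable (Y n) μ)
    (hZ : AEMeasurable Z μ) (hW : AEMeasurable W μ)
    (h : ∀ (I : Finset ℝ≥0) (f : BoundedContinuousFunction E ℝ)
      (g : BoundedContinuousFunction (I → ℝ) ℝ),
      Tendsto (fun n ↦ ∫ ω, f (Y n ω) * g (fun t ↦ W ω t) ∂μ) atTop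
        (𝓝 (∫ ω, f (Z ω) * g (fun t ↦ W ω t) ∂μ))) :
    TendstoInDistribution (fun n ω ↦ (Y n ω, W ω)) atTop (fun ω ↦ (Z ω, W ω))
      (fun _ ↦ μ) μ := by
  wlog hWm : Measurable W generalizing W
  · have hae := hW.ae_eq_mk
    refine TendstoInDistribution.congr (fun n ↦ ?_) ?_
      (this hW.measurable_mk.aemeasurable (fun I f g ↦ ?_) hW.measurable_mk)
    · filter_upwards [hae] with ω hω using by rw [hω]
    · filter_upwards [hae] with ω hω using by rw [hω]
    · have h1 (V : Ω → E) : ∫ ω, f (V ω) * g (fun t ↦ hW.mk W ω t) ∂μ =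
          ∫ ω, f (V ω) * g (fun t ↦ W ω t) ∂μ :=
        integral_congr_ae (by filter_upwards [hae] with ω hω using by rw [hω])
      simp_rw [h1]
      exact h I f g
  -- Any compatible metric will do: it serves only to provide Lipschitz test functions.
  let : MetricSpace C(ℝ≥0, ℝ) := TopologicalSpace.metrizableSpaceMetric _
  refine ⟨fun n ↦ (hY n).prodMk hW, hZ.prodMk hW, ?_⟩
  refine tendsto_iff_forall_lipschitz_integral_tendsto.2 fun G ⟨M, hM⟩ ⟨L, hL⟩ ↦ ?_
  simp only [ProbabilityMeasure.coe_mk]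
  have hm {V : Ω → E} (hV : AEMeasurable V μ) :
      ∫ x, G x ∂(μ.map fun ω ↦ (V ω, W ω)) = ∫ ω, G (V ω, W ω) ∂μ :=
    integral_map (hV.prodMk hW) hL.continuous.measurable.aestronglyMeasurable
  simp_rw [hm (hY _), hm hZ]
  refine tendsto_integral_prodMk_of_setIntegral hY hZ hWm (fun f B hB ↦ ?_) hM hL
  exact tendsto_setIntegral_preimage_contPath
    (fun n ↦ (f.continuous.measurable.comp_aemeasurable (hY n)).aestronglyMeasurable)
    (f.continuous.measurable.comp_aemeasurable hZ).aestronglyMeasurable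
    (fun n ω ↦ f.norm_coe_le_norm _) (fun ω ↦ f.norm_coe_le_norm _) hWm
    (fun I g ↦ h I f g) hB

/-! ### A central limit theorem for rows of independent variables with finitely many laws -/

/-- Exchange the factors one at a time; all the others have norm at most one. -/
lemma norm_prod_sub_prod_le_sum {ι : Type*} (s : Finset ι) {a b : ι → ℂ}
    (ha : ∀ i ∈ s, ‖a i‖ ≤ 1) (hb : ∀ i ∈ s, ‖b i‖ ≤ 1) :
    ‖∏ i ∈ s, a i - ∏ i ∈ s, b i‖ ≤ ∑ i ∈ s, ‖a i - b i‖ := by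
  classical
  induction s using Finset.induction_on with
  | empty => simp
  | insert i s hi ih =>
    rw [Finset.prod_insert hi, Finset.prod_insert hi, Finset.sum_insert hi]
    have ih' := ih (fun j hj ↦ ha j (Finset.mem_insert_of_mem hj))
      fun j hj ↦ hb j (Finset.mem_insert_of_mem hj)
    have h1 : ‖∏ j ∈ s, a j‖ ≤ 1 := by
      rw [norm_prod]
      exact Finset.prod_le_one (fun _ _ ↦ norm_nonneg _)
        fun j hj ↦ ha j (Finset.mem_insert_of_mem hj)
    calc ‖a i * ∏ j ∈ s, a j - b i * ∏ j ∈ s, b j‖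
        = ‖(a i - b i) * ∏ j ∈ s, a j + b i * (∏ j ∈ s, a j - ∏ j ∈ s, b j)‖ := by ring_nf
      _ ≤ ‖a i - b i‖ * ‖∏ j ∈ s, a j‖ + ‖b i‖ * ‖∏ j ∈ s, a j - ∏ j ∈ s, b j‖ := by
        rw [← norm_mul, ← norm_mul]; exact norm_add_le _ _
      _ ≤ ‖a i - b i‖ * 1 + 1 * ∑ j ∈ s, ‖a j - b j‖ := by
        gcongr
        exact hb i (Finset.mem_insert_self _ _)
      _ = _ := by ring

/-- Both functions have the second-order expansion `1 - v t² / 2`. -/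
lemma charFun_sub_exp_isLittleO {S : Type*} [MeasurableSpace S] {ν : Measure S}
    [IsProbabilityMeasure ν] {f : S → ℝ} (hf : MemLp f 2 ν) (hf0 : ∫ x, f x ∂ν = 0) :
    (fun t : ℝ ↦ charFun (ν.map f) t - (Real.exp (-(t ^ 2 / 2 * ∫ x, f x ^ 2 ∂ν)) : ℂ))
      =o[𝓝 0] fun t ↦ t ^ 2 := by
  have hfm : AEMeasurable f ν := hf.aestronglyMeasurable.aemeasurable
  have : IsProbabilityMeasure (ν.map f) := Measure.isProbabilityMeasure_map hfm
  have hid : MemLp id 2 (ν.map f) := (memLp_map_measure_iff (by fun_prop) hfm).2 hf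
  set v := ∫ x, f x ^ 2 ∂ν with hv
  have h1 : (fun t : ℝ ↦ charFun (ν.map f) t - (1 - v * t ^ 2 / 2 : ℂ)) =o[𝓝 0]
      fun t ↦ t ^ 2 := by
    have := taylor_isLittleO_univ (x₀ := 0) (contDiff_charFun (μ := ν.map f) (n := 2) hid)
    simp_rw [taylorWithinEval_charFun_two_zero hfm hid, hf0] at this
    simpa [hv] using this
  have h2 : (fun t : ℝ ↦ (Real.exp (-(t ^ 2 / 2 * v)) : ℂ) - (1 - v * t ^ 2 / 2 : ℂ)) =o[𝓝 0]
      fun t ↦ t ^ 2 := by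
    have he : (fun x : ℝ ↦ Real.exp x - (1 + x)) =o[𝓝 0] fun x ↦ x := by
      have := (hasDerivAt_iff_isLittleO.1 (Real.hasDerivAt_exp 0))
      simpa [sub_sub] using this
    have ht : Tendsto (fun t : ℝ ↦ -(t ^ 2 / 2 * v)) (𝓝 0) (𝓝 0) := by
      have : Continuous fun t : ℝ ↦ -(t ^ 2 / 2 * v) := by fun_prop
      simpa using this.tendsto 0
    have hO : (fun t : ℝ ↦ -(t ^ 2 / 2 * v)) =O[𝓝 0] fun t : ℝ ↦ t ^ 2 :=
      .of_bound (|v| / 2) (.of_forall fun t ↦ by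
        simp only [norm_neg, norm_mul, norm_div, Real.norm_eq_abs, abs_two]
        apply le_of_eq; ring)
    have h3 := (he.comp_tendsto ht).trans_isBigO hO
    refine Asymptotics.IsLittleO.congr_left (f₁ := fun t : ℝ ↦
      (((Real.exp (-(t ^ 2 / 2 * v)) - (1 + -(t ^ 2 / 2 * v)) : ℝ)) : ℂ)) ?_ fun t ↦ ?_
    · rw [← Asymptotics.isLittleO_norm_left] at h3 ⊢
      simpa only [Complex.norm_real] using! h3
    · push_cast; ring
  simpa using h1.sub h2

/-- Each of the `K n` factors differs from its Gaussian counterpart by `o(s n ^ 2)`, uniformly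
because `Θ` is finite, and `s n ^ 2 * K n` is bounded. The types `θ n m` may vary freely with `n`:
the row variances need not converge. -/
theorem tendsto_integral_cexp_rowSum_sub {Ω S Θ : Type*} [MeasurableSpace Ω]
    {μ : Measure Ω} [IsProbabilityMeasure μ] [MeasurableSpace S] {ν : Measure S}
    [IsProbabilityMeasure ν] [Fintype Θ]
    {f : Θ → S → ℝ} (hfm : ∀ θ, Measurable (f θ)) (hf : ∀ θ, MemLp (f θ) 2 ν)
    (hf0 : ∀ θ, ∫ x, f θ x ∂ν = 0) {ξ : ℕ → ℕ → Ω → S} (hξ : ∀ n m, HasLaw (ξ n m) ν μ)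
    (hind : ∀ n, iIndepFun (ξ n) μ) {s : ℕ → ℝ} (hs : Tendsto s atTop (𝓝 0)) {K : ℕ → ℕ} {C : ℝ}
    (hK : ∀ n, s n ^ 2 * K n ≤ C) (θ : ℕ → ℕ → Θ) :
    Tendsto (fun n ↦
      ∫ ω, Complex.exp ((s n * ∑ m ∈ Finset.range (K n), f (θ n m) (ξ n m ω) : ℝ) * Complex.I) ∂μ -
      (Real.exp (-(s n ^ 2 / 2 * ∑ m ∈ Finset.range (K n), ∫ x, f (θ n m) x ^ 2 ∂ν)) : ℂ))
      atTop (𝓝 0) := by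
  let r : Θ → ℝ → ℂ := fun θ t ↦
    charFun (ν.map (f θ)) t - (Real.exp (-(t ^ 2 / 2 * ∫ x, f θ x ^ 2 ∂ν)) : ℂ)
  have hr θ : r θ =o[𝓝 0] fun t ↦ t ^ 2 := charFun_sub_exp_isLittleO (hf θ) (hf0 θ)
  have hprod n : ∫ ω, Complex.exp
      ((s n * ∑ m ∈ Finset.range (K n), f (θ n m) (ξ n m ω) : ℝ) * Complex.I) ∂μ =
      ∏ m ∈ Finset.range (K n), charFun (ν.map (f (θ n m))) (s n) := by
    have hm m : AEMeasurable (fun ω ↦ f (θ n m) (ξ n m ω)) μ :=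
      (hfm _).comp_aemeasurable (hξ n m).aemeasurable
    have h1 := (((hind n).comp (fun m ↦ f (θ n m)) fun m ↦ hfm _).restrict
      (Finset.range (K n))).charFun_map_fun_finsetSum_eq_prod (fun m _ ↦ hm m)
    have h2 := congr_fun h1 (s n)
    rw [charFun_apply_real, integral_map (Finset.aemeasurable_fun_sum _ fun m _ ↦ hm m)
      (by fun_prop)] at h2
    rw [Finset.prod_apply] at h2
    rw [show (∏ m ∈ Finset.range (K n), charFun (ν.map (f (θ n m))) (s n)) =
      ∏ m ∈ Finset.range (K n), charFun (μ.map fun ω ↦ f (θ n m) (ξ n m ω)) (s n) from ?_, ← h2]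
    · push_cast; rfl
    · refine Finset.prod_congr rfl fun m _ ↦ ?_
      rw [← (hξ n m).map_eq, AEMeasurable.map_map_of_aemeasurable (hfm _).aemeasurable
        (hξ n m).aemeasurable]
      rfl
  have hbound n : ‖∫ ω, Complex.exp
      ((s n * ∑ m ∈ Finset.range (K n), f (θ n m) (ξ n m ω) : ℝ) * Complex.I) ∂μ -
      (Real.exp (-(s n ^ 2 / 2 * ∑ m ∈ Finset.range (K n), ∫ x, f (θ n m) x ^ 2 ∂ν)) : ℂ)‖ ≤
      K n * ∑ θ, ‖r θ (s n)‖ := by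
    have h3 : (Real.exp (-(s n ^ 2 / 2 * ∑ m ∈ Finset.range (K n), ∫ x, f (θ n m) x ^ 2 ∂ν)) : ℂ)
        = ∏ m ∈ Finset.range (K n),
          (Real.exp (-(s n ^ 2 / 2 * ∫ x, f (θ n m) x ^ 2 ∂ν)) : ℂ) := by
      rw [← Complex.ofReal_prod, ← Real.exp_sum, Finset.mul_sum, Finset.sum_neg_distrib]
    rw [hprod, h3]
    refine (norm_prod_sub_prod_le_sum _ (fun m _ ↦ ?_) fun m _ ↦ ?_).trans ?_
    · have : IsProbabilityMeasure (ν.map (f (θ n m))) :=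
        Measure.isProbabilityMeasure_map (hfm _).aemeasurable
      exact norm_charFun_le_one _
    · rw [Complex.norm_real, Real.norm_of_nonneg (Real.exp_pos _).le, Real.exp_le_one_iff]
      have : 0 ≤ ∫ x, f (θ n m) x ^ 2 ∂ν := integral_nonneg fun x ↦ sq_nonneg _
      have := mul_nonneg (show 0 ≤ s n ^ 2 / 2 by positivity) this
      linarith
    · calc _ ≤ ∑ m ∈ Finset.range (K n), ∑ θ, ‖r θ (s n)‖ :=
          Finset.sum_le_sum fun m _ ↦ Finset.single_le_sum (f := fun θ ↦ ‖r θ (s n)‖)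
            (fun _ _ ↦ norm_nonneg _) (Finset.mem_univ (θ n m))
        _ = _ := by simp
  have hsum : (fun t ↦ ∑ θ, ‖r θ t‖) =o[𝓝 0] fun t : ℝ ↦ t ^ 2 := by
    have := Asymptotics.IsLittleO.sum (s := Finset.univ) fun θ _ ↦ (hr θ).norm_left
    simpa only [Finset.sum_fn] using this
  have hlim : Tendsto (fun n ↦ K n * ∑ θ, ‖r θ (s n)‖) atTop (𝓝 0) := by
    rw [← Asymptotics.isLittleO_one_iff ℝ]
    have h4 : (fun n ↦ (K n : ℝ) * ∑ θ, ‖r θ (s n)‖) =o[atTop] fun n ↦ (K n : ℝ) * s n ^ 2 :=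
      (Asymptotics.isBigO_refl _ _).mul_isLittleO (hsum.comp_tendsto hs)
    refine h4.trans_isBigO (.of_bound C (.of_forall fun n ↦ ?_))
    rw [Real.norm_of_nonneg (by positivity), norm_one, mul_one, mul_comm]
    exact hK n
  exact squeeze_zero_norm hbound hlim

/-! ### Polynomials of a standard Gaussian variable -/

lemma integrable_eval_gaussianReal (p : Polynomial ℝ) :
    Integrable (fun x ↦ p.eval x) (gaussianReal 0 1) := by
  simp_rw [Polynomial.eval_eq_sum_range]
  refine integrable_finsetSum _ fun k _ ↦ Integrable.const_mul ?_ _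
  have h : Integrable (fun x : ℝ ↦ ‖x ^ k‖) (gaussianReal 0 1) := by
    simpa using (memLp_id_gaussianReal (μ := 0) (v := 1) k).integrable_norm_pow'
  exact (integrable_norm_iff (by fun_prop)).1 h

lemma memLp_eval_gaussianReal (p : Polynomial ℝ) :
    MemLp (fun x ↦ p.eval x) 2 (gaussianReal 0 1) := by
  rw [memLp_two_iff_integrable_sq (by fun_prop)]
  exact (integrable_eval_gaussianReal (p ^ 2)).congr (.of_forall fun x ↦ by simp)

lemma integral_sq_centered_gaussianReal (p : Polynomial ℝ) :
    ∫ x, (p.eval x - gaussianMean p) ^ 2 ∂(gaussianReal 0 1) = gaussianVar p := by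
  rw [gaussianVar, variance_eq_integral (by fun_prop)]
  rfl

lemma memLp_linearCombination_gaussianReal (p : Polynomial ℝ) (a d : ℝ) :
    MemLp (fun x ↦ a * (p.eval x - gaussianMean p) + d * x) 2 (gaussianReal 0 1) := by
  simpa using memLp_eval_gaussianReal
    (.C a * (p - .C (gaussianMean p)) + .C d * .X)

lemma integral_linearCombination_gaussianReal (p : Polynomial ℝ) (a d : ℝ) :
    ∫ x, (a * (p.eval x - gaussianMean p) + d * x) ∂(gaussianReal 0 1) = 0 := by
  have h1 := integrable_eval_gaussianReal p
  have h2 : Integrable (fun x : ℝ ↦ x) (gaussianReal 0 1) := by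
    simpa using integrable_eval_gaussianReal .X
  have h3 : Integrable (fun x ↦ a * (p.eval x - gaussianMean p)) (gaussianReal 0 1) :=
    (h1.sub (integrable_const _)).const_mul a
  rw [integral_add h3 (h2.const_mul d),
    integral_const_mul, integral_const_mul, integral_sub h1 (integrable_const _)]
  simp [gaussianMean]

/-- The rank condition enters here: `E[G (p(G) - E p(G))] = E[G p(G)] = 0`, so there is no cross
term. -/
lemma integral_sq_linearCombination_gaussianReal {p : Polynomial ℝ}
    (hp : CenteredHermiteRankGeTwo p) (a d : ℝ) :
    ∫ x, (a * (p.eval x - gaussianMean p) + d * x) ^ 2 ∂(gaussianReal 0 1) =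
      a ^ 2 * gaussianVar p + d ^ 2 := by
  have h1 : Integrable (fun x ↦ (p.eval x - gaussianMean p) ^ 2) (gaussianReal 0 1) := by
    exact (integrable_eval_gaussianReal ((p - .C (gaussianMean p)) ^ 2)).congr (.of_forall fun x ↦ by simp)
  have h2 : Integrable (fun x ↦ x * p.eval x) (gaussianReal 0 1) := by
    simpa using integrable_eval_gaussianReal (.X * p)
  have h3 : Integrable (fun x : ℝ ↦ x) (gaussianReal 0 1) := by
    simpa using integrable_eval_gaussianReal .X
  have h4 : Integrable (fun x : ℝ ↦ x ^ 2) (gaussianReal 0 1) := by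
    exact (integrable_eval_gaussianReal (.X ^ 2)).congr (.of_forall fun x ↦ by simp)
  have h5 : ∫ x, x ^ 2 ∂(gaussianReal 0 1) = (1 : ℝ) := by
    have := variance_id_gaussianReal (μ := 0) (v := 1)
    rw [variance_eq_integral (by fun_prop)] at this
    simpa using this
  have h6 : ∀ x, (a * (p.eval x - gaussianMean p) + d * x) ^ 2 =
      a ^ 2 * (p.eval x - gaussianMean p) ^ 2 + (2 * a * d) * (x * p.eval x) -
        (2 * a * d * gaussianMean p) * x + d ^ 2 * x ^ 2 := fun x ↦ by ring
  have h7 : Integrable (fun x ↦ a ^ 2 * (p.eval x - gaussianMean p) ^ 2 +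
      (2 * a * d) * (x * p.eval x)) (gaussianReal 0 1) := (h1.const_mul _).add (h2.const_mul _)
  have h8 : Integrable (fun x ↦ a ^ 2 * (p.eval x - gaussianMean p) ^ 2 +
      (2 * a * d) * (x * p.eval x) - (2 * a * d * gaussianMean p) * x) (gaussianReal 0 1) :=
    h7.sub (h3.const_mul _)
  simp_rw [h6]
  rw [integral_add h8 (h4.const_mul _), integral_sub h7 (h3.const_mul _),
    integral_add (h1.const_mul _) (h2.const_mul _)]
  rw [integral_const_mul, integral_const_mul, integral_const_mul, integral_const_mul,
    integral_sq_centered_gaussianReal, hp, h5, integral_id_gaussianReal]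
  simp

/-! ### The rescaled increments -/

section Increments

variable {Ω : Type*} {X : ℝ → Ω → ℝ}

lemma rescaledIncrement_succ_eq (n m : ℕ) (ω : Ω) :
    rescaledIncrement X n (m + 1) ω = (2 : ℝ) ^ ((n : ℝ) / 4) *
      (X ((m + 1 : ℕ) * (2 : ℝ) ^ (-((n : ℝ) / 2))) ω - X (m * (2 : ℝ) ^ (-((n : ℝ) / 2))) ω) := by
  simp only [rescaledIncrement, rescaledProcess]
  push_cast
  rw [add_sub_cancel_right]
  ring

variable [MeasurableSpace Ω] {μ : Measure Ω}

/-- Brownian scaling by `c = 2^{-n/2}`, for which `1/√c = 2^{n/4}`. -/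
lemma exists_isPreBrownianReal_rescaledIncrement
    (hX : IsPreBrownianReal (fun t : ℝ≥0 ↦ X t) μ) (n : ℕ) :
    ∃ W : ℝ≥0 → Ω → ℝ, IsPreBrownianReal W μ ∧
      ∀ m, rescaledIncrement X n (m + 1) = W (m + 1 : ℕ) - W (m : ℕ) := by
  have hc : (2 : ℝ≥0) ^ (-((n : ℝ) / 2)) ≠ 0 := by positivity
  refine ⟨_, hX.smul hc, fun m ↦ ?_⟩
  ext ω
  have h : (√(((2 : ℝ≥0) ^ (-((n : ℝ) / 2)) : ℝ≥0) : ℝ))⁻¹ = (2 : ℝ) ^ ((n : ℝ) / 4) := by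
    rw [NNReal.coe_rpow, Real.sqrt_eq_rpow, ← Real.rpow_mul (by simp), ← Real.rpow_neg (by simp)]
    simp only [NNReal.coe_ofNat]
    ring_nf
  rw [rescaledIncrement_succ_eq, Pi.sub_apply, h]
  simp only [NNReal.coe_mul, NNReal.coe_rpow, NNReal.coe_natCast, NNReal.coe_ofNat]
  rw [mul_comm ((2 : ℝ) ^ (-((n : ℝ) / 2))), mul_comm ((2 : ℝ) ^ (-((n : ℝ) / 2)))]
  ring

lemma hasLaw_rescaledIncrement (hX : IsPreBrownianReal (fun t : ℝ≥0 ↦ X t) μ) (n m : ℕ) :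
    HasLaw (rescaledIncrement X n (m + 1)) (gaussianReal 0 1) μ := by
  obtain ⟨W, hW, h⟩ := exists_isPreBrownianReal_rescaledIncrement hX n
  rw [h]
  have := hW.hasLaw_sub (m + 1 : ℕ) (m : ℕ)
  convert this using 2
  ext
  simp

lemma iIndepFun_rescaledIncrement (hX : IsPreBrownianReal (fun t : ℝ≥0 ↦ X t) μ) (n : ℕ) :
    iIndepFun (fun m ↦ rescaledIncrement X n (m + 1)) μ := by
  obtain ⟨W, hW, h⟩ := exists_isPreBrownianReal_rescaledIncrement hX n
  simp_rw [h]
  exact hW.hasIndepIncrements.nat (t := fun m : ℕ ↦ (m : ℝ≥0)) Nat.mono_cast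

end Increments

/-! ### The grid -/

/-- The index `⌊x 2^{n/2}⌋` of the last point of the `n`-th grid before `x`. -/
noncomputable def gridIndex (n : ℕ) (x : ℝ) : ℕ := ⌊x * (2 : ℝ) ^ ((n : ℝ) / 2)⌋₊

/-- The normalization `2^{-n/4}`. -/
noncomputable def gridScale (n : ℕ) : ℝ := (2 : ℝ) ^ (-((n : ℝ) / 4))

lemma gridIndex_mono (n : ℕ) : Monotone (gridIndex n) := fun _ _ h ↦ by
  unfold gridIndex
  gcongr

lemma gridScale_sq (n : ℕ) : gridScale n ^ 2 = ((2 : ℝ) ^ ((n : ℝ) / 2))⁻¹ := by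
  rw [gridScale, ← Real.rpow_natCast, ← Real.rpow_mul (by simp), ← Real.rpow_neg (by simp)]
  congr 1
  push_cast
  ring

lemma tendsto_two_rpow_half : Tendsto (fun n : ℕ ↦ (2 : ℝ) ^ ((n : ℝ) / 2)) atTop atTop :=
  (tendsto_rpow_atTop_of_base_gt_one 2 one_lt_two).comp
    (tendsto_natCast_atTop_atTop.atTop_div_const two_pos)

lemma tendsto_gridScale_sq : Tendsto (fun n ↦ gridScale n ^ 2) atTop (𝓝 0) := by
  simp_rw [gridScale_sq]
  exact tendsto_inv_atTop_zero.comp tendsto_two_rpow_half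

lemma tendsto_gridScale : Tendsto gridScale atTop (𝓝 0) := by
  have := tendsto_gridScale_sq.sqrt
  simpa [Real.sqrt_sq (show 0 ≤ gridScale _ from (Real.rpow_pos_of_pos two_pos _).le)] using this

lemma tendsto_gridScale_sq_mul_gridIndex {x : ℝ} (hx : 0 ≤ x) :
    Tendsto (fun n ↦ gridScale n ^ 2 * gridIndex n x) atTop (𝓝 x) := by
  have := (tendsto_nat_floor_mul_div_atTop hx).comp tendsto_two_rpow_half
  refine this.congr fun n ↦ ?_
  rw [gridScale_sq, Function.comp_apply, gridIndex]
  ring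

lemma gridScale_sq_mul_gridIndex_le {x : ℝ} (hx : 0 ≤ x) (n : ℕ) :
    gridScale n ^ 2 * gridIndex n x ≤ x := by
  rw [gridScale_sq, gridIndex, inv_mul_le_iff₀ (by positivity), mul_comm]
  exact Nat.floor_le (by positivity)

lemma parityWeight_eq (α β : ℝ) (i : ℕ) :
    parityWeight α β i = (α + β) / 2 + (-1) ^ i * ((α - β) / 2) := by
  unfold parityWeight
  split_ifs with h
  · rw [h.neg_one_pow]; ring
  · rw [(Nat.not_even_iff_odd.1 h).neg_one_pow]; ring

lemma sum_range_parityWeight (α β : ℝ) (k : ℕ) :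
    ∑ m ∈ Finset.range k, parityWeight α β (m + 1) =
      (α + β) / 2 * k - (if Even k then 0 else 1) * ((α - β) / 2) := by
  simp_rw [parityWeight_eq, pow_succ]
  rw [Finset.sum_add_distrib, ← Finset.sum_mul, ← Finset.sum_mul, neg_one_geom_sum]
  simp
  ring

/-- The weight is its mean plus an alternating term, whose partial sums stay bounded and vanish
after normalization. -/
lemma tendsto_gridScale_sq_mul_sum_range (α β : ℝ) {x : ℝ} (hx : 0 ≤ x) :
    Tendsto (fun n ↦ gridScale n ^ 2 *
      ∑ m ∈ Finset.range (gridIndex n x), parityWeight α β (m + 1)) atTop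
      (𝓝 ((α + β) / 2 * x)) := by
  have h1 := (tendsto_gridScale_sq_mul_gridIndex hx).const_mul ((α + β) / 2)
  have h2 : Tendsto (fun n ↦ gridScale n ^ 2 *
      ((if Even (gridIndex n x) then 0 else 1) * ((α - β) / 2))) atTop (𝓝 0) := by
    refine tendsto_gridScale_sq.zero_mul_isBoundedUnder_le
      (isBoundedUnder_of ⟨|(α - β) / 2|, fun n ↦ ?_⟩)
    simp only [Function.comp_apply, Real.norm_eq_abs]
    split_ifs <;> simp
  have h3 := h1.sub h2
  rw [sub_zero] at h3
  refine h3.congr fun n ↦ ?_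
  rw [sum_range_parityWeight]
  ring

lemma tendsto_gridScale_sq_mul_sum_Ico (α β : ℝ) {x y : ℝ} (hx : 0 ≤ x) (hxy : x ≤ y) :
    Tendsto (fun n ↦ gridScale n ^ 2 *
      ∑ m ∈ Finset.Ico (gridIndex n x) (gridIndex n y), parityWeight α β (m + 1)) atTop
      (𝓝 ((α + β) / 2 * (y - x))) := by
  have h := (tendsto_gridScale_sq_mul_sum_range α β (hx.trans hxy)).sub
    (tendsto_gridScale_sq_mul_sum_range α β hx)
  rw [← mul_sub] at h
  refine h.congr fun n ↦ ?_
  rw [Finset.sum_Ico_eq_sub _ (gridIndex_mono n hxy), mul_sub]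

/-- The order of `x` and `y` is left free because the lemma is used with `y = min (j + 1) (τ t)`,
which may precede `x = j`. -/
lemma tendsto_gridScale_sq_mul_sum_Ico_neg_one_pow {x y : ℝ} (hx : 0 ≤ x) :
    Tendsto (fun n ↦ gridScale n ^ 2 *
      ∑ m ∈ Finset.Ico (gridIndex n x) (gridIndex n y), parityWeight 1 (-1) (m + 1)) atTop
      (𝓝 0) := by
  rcases le_total x y with hxy | hxy
  · simpa using tendsto_gridScale_sq_mul_sum_Ico 1 (-1) hx hxy
  · have h n : Finset.Ico (gridIndex n x) (gridIndex n y) = ∅ :=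
      Finset.Ico_eq_empty_of_le (gridIndex_mono n hxy)
    simp [h]

lemma sum_blockIndices_succ (n j : ℕ) (F : ℕ → ℝ) :
    ∑ i ∈ blockIndices n (j + 1), F i =
      ∑ m ∈ Finset.Ico (gridIndex n j) (gridIndex n (j + 1)), F (m + 1) := by
  rw [blockIndices]
  push_cast
  rw [add_sub_cancel_right]
  exact (Finset.sum_Ico_add' F (gridIndex n j) (gridIndex n (j + 1)) 1).symm

/-- A telescoping sum in which the scalings `2^{-n/4}` and `2^{n/4}` cancel; it expresses values of
`X` through the same increments as the block sums. -/
lemma sum_range_gridScale_mul_increment {Ω : Type*} (X : ℝ → Ω → ℝ) (n k : ℕ) (ω : Ω) :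
    gridScale n * ∑ m ∈ Finset.range k, rescaledIncrement X n (m + 1) ω =
      X (k * (2 : ℝ) ^ (-((n : ℝ) / 2))) ω - X 0 ω := by
  simp_rw [rescaledIncrement_succ_eq]
  rw [← Finset.mul_sum,
    Finset.sum_range_sub (fun m : ℕ ↦ X (m * (2 : ℝ) ^ (-((n : ℝ) / 2))) ω), gridScale,
    ← mul_assoc, ← Real.rpow_add two_pos]
  simp

lemma tendsto_apply_gridIndex {Ω : Type*} {X : ℝ → Ω → ℝ} {ω : Ω}
    (hX : Continuous fun t : ℝ≥0 ↦ X t ω) (t : ℝ≥0) :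
    Tendsto (fun n ↦ X (gridIndex n t * (2 : ℝ) ^ (-((n : ℝ) / 2))) ω) atTop (𝓝 (X t ω)) := by
  have h := tendsto_gridScale_sq_mul_gridIndex t.2
  have h' : Tendsto (fun n ↦ Real.toNNReal (gridScale n ^ 2 * gridIndex n t)) atTop (𝓝 t) := by
    simpa [Function.comp_def] using (continuous_real_toNNReal.tendsto _).comp h
  refine ((hX.tendsto t).comp h').congr fun n ↦ ?_
  simp only [Function.comp_apply]
  rw [Real.coe_toNNReal _ (by positivity), gridScale_sq, Real.rpow_neg two_pos.le, mul_comm]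

/-! ### Characteristic functions of the block sums and finitely many values of `X` -/

section BlockSums

variable {Ω κ : Type*} [Fintype κ] {N : ℕ}

/-- The blocks (at most one of them) that contain the index `m + 1`. -/
noncomputable def activeBlocks (N n m : ℕ) : Finset (Fin N) :=
  Finset.univ.filter fun j ↦ gridIndex n j ≤ m ∧ m < gridIndex n (j + 1)

/-- The times `τ t` that are not before the `m + 1`-st point of the `n`-th grid. -/
noncomputable def activeTimes (τ : κ → ℝ≥0) (n m : ℕ) : Finset κ :=
  Finset.univ.filter fun t ↦ m < gridIndex n (τ t)

/-- The parity, block and times of the index `m + 1`. -/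
noncomputable def rowIndex (N : ℕ) (τ : κ → ℝ≥0) (n m : ℕ) :
    Bool × Finset (Fin N) × Finset κ :=
  (decide (Even (m + 1)), activeBlocks N n m, activeTimes τ n m)

/-- The contribution of an increment `x` of given parity, block and times to a linear combination
of the block sums and the values of `X`. -/
noncomputable def rowFun (p : Polynomial ℝ) (α β : ℝ) (u v : Fin N → ℝ) (l : κ → ℝ)
    (θ : Bool × Finset (Fin N) × Finset κ) (x : ℝ) : ℝ :=
  ((∑ j ∈ θ.2.1, u j) * (if θ.1 then α else β)) * (p.eval x - gaussianMean p) +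
    ((∑ j ∈ θ.2.1, v j) * (if θ.1 then 1 else -1) + ∑ t ∈ θ.2.2, l t) * x

/-- A linear combination of the block sums and of the increments of `X` up to grid points. -/
noncomputable def gridCombination (X : ℝ → Ω → ℝ) (p : Polynomial ℝ) (α β : ℝ)
    (u v : Fin N → ℝ) (l : κ → ℝ) (τ : κ → ℝ≥0) (n : ℕ) (ω : Ω) : ℝ :=
  ∑ j, u j * polyBlockSum X p α β n (j + 1) ω + ∑ j, v j * signedBlockSum X n (j + 1) ω +
    ∑ t, l t * (X (gridIndex n (τ t) * (2 : ℝ) ^ (-((n : ℝ) / 2))) ω - X 0 ω)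

/-- A time horizon that exceeds all blocks and all times `τ t`. -/
noncomputable def timeHorizon (N : ℕ) (τ : κ → ℝ≥0) : ℝ := N + ∑ t, (τ t : ℝ)

lemma timeHorizon_nonneg (N : ℕ) (τ : κ → ℝ≥0) : 0 ≤ timeHorizon N τ := by
  unfold timeHorizon
  positivity

lemma succ_le_timeHorizon (τ : κ → ℝ≥0) (j : Fin N) : (j + 1 : ℝ) ≤ timeHorizon N τ := by
  have h1 : ((j : ℕ) + 1 : ℝ) ≤ N := by exact_mod_cast j.2
  have h2 : 0 ≤ ∑ t, (τ t : ℝ) := by positivity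
  unfold timeHorizon
  linarith

lemma le_timeHorizon (N : ℕ) (τ : κ → ℝ≥0) (t : κ) : τ t ≤ timeHorizon N τ := by
  have h1 : (τ t : ℝ) ≤ ∑ t, (τ t : ℝ) :=
    Finset.single_le_sum (f := fun t ↦ (τ t : ℝ)) (fun _ _ ↦ NNReal.coe_nonneg _)
      (Finset.mem_univ t)
  have h2 : (0 : ℝ) ≤ N := by positivity
  unfold timeHorizon
  linarith

lemma sum_range_sum_activeBlocks (τ : κ → ℝ≥0) (n : ℕ) (F : ℕ → Fin N → ℝ) :
    ∑ m ∈ Finset.range (gridIndex n (timeHorizon N τ)), ∑ j ∈ activeBlocks N n m, F m j =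
      ∑ j : Fin N, ∑ m ∈ Finset.Ico (gridIndex n j) (gridIndex n (j + 1)), F m j := by
  refine Finset.sum_comm' fun m j ↦ ?_
  have := gridIndex_mono n (succ_le_timeHorizon τ j)
  simp only [activeBlocks, Finset.mem_range, Finset.mem_filter, Finset.mem_univ, true_and,
    Finset.mem_Ico, and_true]
  exact ⟨fun h ↦ h.2, fun h ↦ ⟨h.2.trans_le this, h⟩⟩

lemma sum_range_sum_activeTimes (N : ℕ) (τ : κ → ℝ≥0) (n : ℕ) (F : ℕ → κ → ℝ) :
    ∑ m ∈ Finset.range (gridIndex n (timeHorizon N τ)), ∑ t ∈ activeTimes τ n m, F m t =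
      ∑ t, ∑ m ∈ Finset.range (gridIndex n (τ t)), F m t := by
  refine Finset.sum_comm' fun m t ↦ ?_
  have := gridIndex_mono n (le_timeHorizon N τ t)
  simp only [activeTimes, Finset.mem_range, Finset.mem_filter, Finset.mem_univ, true_and, and_true]
  exact ⟨fun h ↦ h.2, fun h ↦ ⟨h.trans_le this, h⟩⟩

/-- The part of the block `[j, j + 1)` before `τ t` ends at `min (j + 1) (τ t)`, and the horizon
cuts nothing off. -/
lemma sum_range_sum_activeBlocks_activeTimes (τ : κ → ℝ≥0) (n : ℕ) (F : ℕ → Fin N → κ → ℝ) :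
    ∑ m ∈ Finset.range (gridIndex n (timeHorizon N τ)),
      ∑ j ∈ activeBlocks N n m, ∑ t ∈ activeTimes τ n m, F m j t =
      ∑ j : Fin N, ∑ t, ∑ m ∈ Finset.Ico (gridIndex n j) (gridIndex n (min (j + 1) (τ t))),
        F m j t := by
  simp_rw [← Finset.sum_product']
  refine Finset.sum_comm' fun m jt ↦ ?_
  obtain ⟨j, t⟩ := jt
  have := gridIndex_mono n (le_timeHorizon N τ t)
  simp only [activeTimes, activeBlocks, Finset.mem_range, Finset.mem_filter, Finset.mem_univ,
    true_and, and_true, Finset.mem_product, Finset.mem_Ico, (gridIndex_mono n).map_min, lt_min_iff]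
  exact ⟨fun h ↦ ⟨h.2.1.1, h.2.1.2, h.2.2⟩, fun h ↦ ⟨h.2.2.trans_le this, ⟨h.1, h.2.1⟩, h.2.2⟩⟩

/-- Blocks are disjoint, so the sum has at most one term. This is why distinct blocks are
uncorrelated. -/
lemma activeBlocks_sum_sq (n m : ℕ) (u : Fin N → ℝ) :
    (∑ j ∈ activeBlocks N n m, u j) ^ 2 = ∑ j ∈ activeBlocks N n m, u j ^ 2 := by
  have huniq : ∀ i ∈ activeBlocks N n m, ∀ j ∈ activeBlocks N n m, i ≤ j := by
    intro i hi j hj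
    simp only [activeBlocks, Finset.mem_filter, Finset.mem_univ, true_and] at hi hj
    by_contra! h
    have h1 : ((j : ℕ) + 1 : ℝ) ≤ (i : ℕ) := by exact_mod_cast h
    have := gridIndex_mono n h1
    omega
  rcases (activeBlocks N n m).eq_empty_or_nonempty with h | ⟨i, hi⟩
  · simp [h]
  · have : activeBlocks N n m = {i} := Finset.eq_singleton_iff_unique_mem.2
      ⟨hi, fun j hj ↦ le_antisymm (huniq j hj i hi) (huniq i hi j hj)⟩
    simp [this]

lemma gridScale_mul_sum_rowFun (X : ℝ → Ω → ℝ) (p : Polynomial ℝ) (α β : ℝ)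
    (u v : Fin N → ℝ) (l : κ → ℝ) (τ : κ → ℝ≥0) (n : ℕ) (ω : Ω) :
    gridScale n * ∑ m ∈ Finset.range (gridIndex n (timeHorizon N τ)),
      rowFun p α β u v l (rowIndex N τ n m) (rescaledIncrement X n (m + 1) ω) =
      gridCombination X p α β u v l τ n ω := by
  have h1 m : rowFun p α β u v l (rowIndex N τ n m) (rescaledIncrement X n (m + 1) ω) =
      ∑ j ∈ activeBlocks N n m, u j * (parityWeight α β (m + 1) *
        (p.eval (rescaledIncrement X n (m + 1) ω) - gaussianMean p)) +
      ∑ j ∈ activeBlocks N n m, v j * ((-1) ^ (m + 1) * rescaledIncrement X n (m + 1) ω) +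
      ∑ t ∈ activeTimes τ n m, l t * rescaledIncrement X n (m + 1) ω := by
    have h2 : (-1 : ℝ) ^ (m + 1) = if Even (m + 1) then 1 else -1 := by
      split_ifs with h
      · exact h.neg_one_pow
      · exact (Nat.not_even_iff_odd.1 h).neg_one_pow
    simp only [rowFun, rowIndex, decide_eq_true_eq, ← Finset.sum_mul, parityWeight, h2]
    ring
  simp_rw [h1]
  rw [Finset.sum_add_distrib, Finset.sum_add_distrib, sum_range_sum_activeBlocks,
    sum_range_sum_activeBlocks, sum_range_sum_activeTimes, mul_add, mul_add, gridCombination]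
  simp_rw [← sum_range_gridScale_mul_increment, polyBlockSum, signedBlockSum,
    sum_blockIndices_succ, ← Finset.mul_sum]
  refine congrArg₂ (· + ·) (congrArg₂ (· + ·) ?_ ?_) ?_ <;>
    (rw [Finset.mul_sum]; exact Finset.sum_congr rfl fun _ _ ↦ mul_left_comm (gridScale n) _ _)

/-- The part quadratic in `l` is kept as the case `u = v = 0`. The rest is written with parity
weights, including the constant weight `parityWeight 1 1`, so that one averaging lemma covers the
block variances; the products `v j * l t` carry the alternating weight. -/
lemma integral_sq_rowFun {p : Polynomial ℝ} (hp : CenteredHermiteRankGeTwo p) (α β : ℝ)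
    (u v : Fin N → ℝ) (l : κ → ℝ) (τ : κ → ℝ≥0) (n m : ℕ) :
    ∫ x, rowFun p α β u v l (rowIndex N τ n m) x ^ 2 ∂(gaussianReal 0 1) =
      ∫ x, rowFun p α β 0 0 l (rowIndex N τ n m) x ^ 2 ∂(gaussianReal 0 1) +
      (∑ j ∈ activeBlocks N n m,
        (u j ^ 2 * gaussianVar p) * parityWeight (α ^ 2) (β ^ 2) (m + 1) +
      ∑ j ∈ activeBlocks N n m, v j ^ 2 * parityWeight 1 1 (m + 1) +
      ∑ j ∈ activeBlocks N n m, ∑ t ∈ activeTimes τ n m,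
        (2 * (v j * l t)) * parityWeight 1 (-1) (m + 1)) := by
  simp only [rowFun]
  rw [integral_sq_linearCombination_gaussianReal hp, integral_sq_linearCombination_gaussianReal hp]
  simp only [← Finset.sum_mul, ← Finset.mul_sum, rowIndex, parityWeight, decide_eq_true_eq,
    ← activeBlocks_sum_sq, Pi.zero_apply, Finset.sum_const_zero]
  split_ifs <;> ring

lemma tendsto_gridScale_sq_mul_sum_integral_sq_sub {p : Polynomial ℝ}
    (hp : CenteredHermiteRankGeTwo p) (α β : ℝ)
    (u v : Fin N → ℝ) (l : κ → ℝ) (τ : κ → ℝ≥0) :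
    Tendsto (fun n ↦
      gridScale n ^ 2 * ∑ m ∈ Finset.range (gridIndex n (timeHorizon N τ)),
        ∫ x, rowFun p α β u v l (rowIndex N τ n m) x ^ 2 ∂(gaussianReal 0 1) -
      gridScale n ^ 2 * ∑ m ∈ Finset.range (gridIndex n (timeHorizon N τ)),
        ∫ x, rowFun p α β 0 0 l (rowIndex N τ n m) x ^ 2 ∂(gaussianReal 0 1)) atTop
      (𝓝 (∑ j, u j ^ 2 * gaussianVar p * ((α ^ 2 + β ^ 2) / 2) + ∑ j, v j ^ 2)) := by
  have h1 (x y : ℝ) (j : Fin N) : Tendsto (fun n ↦ gridScale n ^ 2 *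
      ∑ m ∈ Finset.Ico (gridIndex n j) (gridIndex n (j + 1)), parityWeight x y (m + 1)) atTop
      (𝓝 ((x + y) / 2)) := by
    simpa using tendsto_gridScale_sq_mul_sum_Ico x y (Nat.cast_nonneg (j : ℕ))
      (show ((j : ℕ) : ℝ) ≤ (j : ℕ) + 1 by linarith)
  have hA : Tendsto (fun n ↦ ∑ j : Fin N, (u j ^ 2 * gaussianVar p) * (gridScale n ^ 2 *
      ∑ m ∈ Finset.Ico (gridIndex n j) (gridIndex n (j + 1)),
        parityWeight (α ^ 2) (β ^ 2) (m + 1))) atTop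
      (𝓝 (∑ j, u j ^ 2 * gaussianVar p * ((α ^ 2 + β ^ 2) / 2))) :=
    tendsto_finsetSum _ fun j _ ↦ (h1 _ _ j).const_mul _
  have hB : Tendsto (fun n ↦ ∑ j : Fin N, v j ^ 2 * (gridScale n ^ 2 *
      ∑ m ∈ Finset.Ico (gridIndex n j) (gridIndex n (j + 1)), parityWeight 1 1 (m + 1))) atTop
      (𝓝 (∑ j, v j ^ 2 * ((1 + 1) / 2))) :=
    tendsto_finsetSum _ fun j _ ↦ (h1 _ _ j).const_mul _
  have hC : Tendsto (fun n ↦ ∑ j : Fin N, ∑ t, (2 * (v j * l t)) * (gridScale n ^ 2 *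
      ∑ m ∈ Finset.Ico (gridIndex n j) (gridIndex n (min (j + 1) (τ t))),
        parityWeight 1 (-1) (m + 1))) atTop
      (𝓝 (∑ j, ∑ t, (2 * (v j * l t)) * 0)) :=
    tendsto_finsetSum _ fun j _ ↦ tendsto_finsetSum _ fun t _ ↦
      (tendsto_gridScale_sq_mul_sum_Ico_neg_one_pow (Nat.cast_nonneg (j : ℕ))).const_mul _
  have h := (hA.add hB).add hC
  norm_num at h
  refine h.congr fun n ↦ ?_
  simp_rw [integral_sq_rowFun hp α β u v l]
  rw [Finset.sum_add_distrib, mul_add, add_sub_cancel_left, Finset.sum_add_distrib,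
    Finset.sum_add_distrib, sum_range_sum_activeBlocks, sum_range_sum_activeBlocks,
    sum_range_sum_activeBlocks_activeTimes]
  simp_rw [← Finset.mul_sum]
  rw [mul_add, mul_add]
  refine congrArg₂ (· + ·) (congrArg₂ (· + ·) ?_ ?_) ?_ <;>
    (rw [Finset.mul_sum]; refine Finset.sum_congr rfl fun _ _ ↦ ?_)
  · exact (mul_left_comm _ _ _).symm
  · exact (mul_left_comm _ _ _).symm
  · rw [Finset.mul_sum]
    exact Finset.sum_congr rfl fun _ _ ↦ (mul_left_comm _ _ _).symm

variable {X : ℝ → Ω → ℝ}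

lemma tendsto_gridCombination_zero {ω : Ω} (hω : Continuous fun t : ℝ≥0 ↦ X t ω)
    (h0 : X 0 ω = 0) (p : Polynomial ℝ) (α β : ℝ) (l : κ → ℝ) (τ : κ → ℝ≥0) :
    Tendsto (fun n ↦ gridCombination X p α β (0 : Fin N → ℝ) 0 l τ n ω) atTop
      (𝓝 (∑ t, l t * X (τ t) ω)) := by
  simp only [gridCombination, Pi.zero_apply, zero_mul, Finset.sum_const_zero, zero_add, h0,
    sub_zero]
  exact tendsto_finsetSum _ fun t _ ↦ (tendsto_apply_gridIndex hω (τ t)).const_mul _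

variable [MeasurableSpace Ω] {μ : Measure Ω}

lemma aemeasurable_apply_of_nonneg (hX : IsPreBrownianReal (fun t : ℝ≥0 ↦ X t) μ) {t : ℝ}
    (ht : 0 ≤ t) : AEMeasurable (X t) μ := hX.aemeasurable ⟨t, ht⟩

lemma aemeasurable_rescaledIncrement (hX : IsPreBrownianReal (fun t : ℝ≥0 ↦ X t) μ) (n m : ℕ) :
    AEMeasurable (rescaledIncrement X n (m + 1)) μ := (hasLaw_rescaledIncrement hX n m).aemeasurable

lemma aemeasurable_polyBlockSum (hX : IsPreBrownianReal (fun t : ℝ≥0 ↦ X t) μ)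
    (p : Polynomial ℝ) (α β : ℝ) (n j : ℕ) :
    AEMeasurable (polyBlockSum X p α β n (j + 1)) μ := by
  unfold polyBlockSum
  simp_rw [sum_blockIndices_succ]
  refine .const_mul (Finset.aemeasurable_fun_sum _ fun m _ ↦ ?_) _
  exact ((p.continuous.measurable.comp_aemeasurable (aemeasurable_rescaledIncrement hX n m)).sub_const
    _).const_mul _

lemma aemeasurable_signedBlockSum (hX : IsPreBrownianReal (fun t : ℝ≥0 ↦ X t) μ) (n j : ℕ) :
    AEMeasurable (signedBlockSum X n (j + 1)) μ := by
  unfold signedBlockSum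
  simp_rw [sum_blockIndices_succ]
  exact .const_mul (Finset.aemeasurable_fun_sum _ fun m _ ↦
    (aemeasurable_rescaledIncrement hX n m).const_mul _) _

lemma aemeasurable_gridCombination (hX : IsPreBrownianReal (fun t : ℝ≥0 ↦ X t) μ)
    (p : Polynomial ℝ) (α β : ℝ) (u v : Fin N → ℝ) (l : κ → ℝ) (τ : κ → ℝ≥0) (n : ℕ) :
    AEMeasurable (gridCombination X p α β u v l τ n) μ := by
  unfold gridCombination
  refine ((Finset.aemeasurable_fun_sum _ fun j _ ↦ ?_).add
    (Finset.aemeasurable_fun_sum _ fun j _ ↦ ?_)).add (Finset.aemeasurable_fun_sum _ fun t _ ↦ ?_)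
  · exact (aemeasurable_polyBlockSum hX p α β n j).const_mul _
  · exact (aemeasurable_signedBlockSum hX n j).const_mul _
  · exact ((aemeasurable_apply_of_nonneg hX (by positivity)).sub
      (aemeasurable_apply_of_nonneg hX le_rfl)).const_mul _

variable [IsProbabilityMeasure μ]

lemma tendsto_integral_cexp_gridCombination_sub (hX : IsPreBrownianReal (fun t : ℝ≥0 ↦ X t) μ)
    (p : Polynomial ℝ) (α β : ℝ) (u v : Fin N → ℝ) (l : κ → ℝ) (τ : κ → ℝ≥0) :
    Tendsto (fun n ↦
      ∫ ω, Complex.exp (gridCombination X p α β u v l τ n ω * Complex.I) ∂μ -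
      (Real.exp (-(gridScale n ^ 2 / 2 *
        ∑ m ∈ Finset.range (gridIndex n (timeHorizon N τ)),
          ∫ x, rowFun p α β u v l (rowIndex N τ n m) x ^ 2 ∂(gaussianReal 0 1))) : ℂ))
      atTop (𝓝 0) := by
  have := tendsto_integral_cexp_rowSum_sub (μ := μ) (ν := gaussianReal 0 1)
    (f := rowFun p α β u v l) (fun θ ↦ by unfold rowFun; fun_prop)
    (fun θ ↦ memLp_linearCombination_gaussianReal p _ _)
    (fun θ ↦ integral_linearCombination_gaussianReal p _ _)
    (hasLaw_rescaledIncrement hX) (iIndepFun_rescaledIncrement hX) tendsto_gridScale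
    (gridScale_sq_mul_gridIndex_le (timeHorizon_nonneg N τ)) (rowIndex N τ)
  simpa only [gridScale_mul_sum_rowFun] using this

/-- The covariance of the values of `X` is never computed. The row estimate with `u = v = 0`
identifies the limit of their Gaussian factor, since path continuity already gives the limit of the
left-hand integral. -/
lemma tendsto_integral_cexp_gridCombination (hX : IsBrownianReal (fun t : ℝ≥0 ↦ X t) μ)
    {p : Polynomial ℝ} (hp : CenteredHermiteRankGeTwo p) (α β : ℝ) (u v : Fin N → ℝ) (l : κ → ℝ)
    (τ : κ → ℝ≥0) :
    Tendsto (fun n ↦ ∫ ω, Complex.exp (gridCombination X p α β u v l τ n ω * Complex.I) ∂μ) atTop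
      (𝓝 ((∫ ω, Complex.exp ((∑ t, l t * X (τ t) ω : ℝ) * Complex.I) ∂μ) *
        (Real.exp (-((∑ j, u j ^ 2 * gaussianVar p * ((α ^ 2 + β ^ 2) / 2) +
          ∑ j, v j ^ 2) / 2)) : ℂ))) := by
  have hzero : Tendsto (fun n ↦ ∫ ω, Complex.exp
      (gridCombination X p α β (0 : Fin N → ℝ) 0 l τ n ω * Complex.I) ∂μ) atTop
      (𝓝 (∫ ω, Complex.exp ((∑ t, l t * X (τ t) ω : ℝ) * Complex.I) ∂μ)) := by
    refine tendsto_integral_of_dominated_convergence (fun _ ↦ 1) (fun n ↦ ?_)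
      (integrable_const _) (fun n ↦ .of_forall fun ω ↦ (Complex.norm_exp_ofReal_mul_I _).le) ?_
    · have := aemeasurable_gridCombination hX.toIsPreBrownianReal p α β (0 : Fin N → ℝ) 0 l τ n
      exact AEMeasurable.aestronglyMeasurable (by fun_prop)
    · filter_upwards [hX.cont, hX.eval_zero_ae_eq_zero] with ω hω h0
      have hc : Continuous fun x : ℝ ↦ Complex.exp (x * Complex.I) := by fun_prop
      exact (hc.tendsto _).comp (tendsto_gridCombination_zero hω (by simpa using h0) p α β l τ)
  have h0 := tendsto_integral_cexp_gridCombination_sub hX.toIsPreBrownianReal p α β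
    (0 : Fin N → ℝ) 0 l τ
  have h1 := tendsto_integral_cexp_gridCombination_sub hX.toIsPreBrownianReal p α β u v l τ
  have hG := hzero.sub h0
  simp only [sub_sub_cancel, sub_zero] at hG
  have hdiff : Tendsto (fun n ↦ (Real.exp (-((gridScale n ^ 2 *
      ∑ m ∈ Finset.range (gridIndex n (timeHorizon N τ)),
        ∫ x, rowFun p α β u v l (rowIndex N τ n m) x ^ 2 ∂(gaussianReal 0 1) -
      gridScale n ^ 2 * ∑ m ∈ Finset.range (gridIndex n (timeHorizon N τ)),
        ∫ x, rowFun p α β 0 0 l (rowIndex N τ n m) x ^ 2 ∂(gaussianReal 0 1)) / 2)) : ℂ)) atTop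
      (𝓝 (Real.exp (-((∑ j, u j ^ 2 * gaussianVar p * ((α ^ 2 + β ^ 2) / 2) +
          ∑ j, v j ^ 2) / 2)) : ℂ)) :=
    (Complex.continuous_ofReal.tendsto _).comp ((Real.continuous_exp.tendsto _).comp
      ((tendsto_gridScale_sq_mul_sum_integral_sq_sub hp α β u v l τ).div_const 2).neg)
  -- The full Gaussian factor is the one for `u = v = 0` times the exponential of the variance
  -- difference.
  have h := h1.add (hG.mul hdiff)
  rw [zero_add] at h
  refine h.congr fun n ↦ ?_
  rw [← Complex.ofReal_mul, ← Real.exp_add]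
  rw [sub_add_eq_add_sub, sub_eq_iff_eq_add, add_right_inj]
  congr 2
  ring

end BlockSums

/-! ### From characteristic functions to the theorem -/

/-- Lévy's continuity theorem for the joint vector indexed by `ι ⊕ κ`, tested against the product of
`f` and `g`. -/
lemma tendsto_integral_mul_of_tendsto_integral_cexp {Ω ι κ : Type*} [Fintype ι] [Fintype κ]
    [MeasurableSpace Ω] {μ : Measure Ω} [IsProbabilityMeasure μ] {Y : ℕ → Ω → ι → ℝ}
    {Z : Ω → ι → ℝ} {V : Ω → κ → ℝ} (hY : ∀ n, AEMeasurable (Y n) μ) (hZ : AEMeasurable Z μ)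
    (hV : AEMeasurable V μ)
    (h : ∀ (w : ι → ℝ) (l : κ → ℝ), Tendsto (fun n ↦ ∫ ω, Complex.exp
      ((∑ i, w i * Y n ω i + ∑ t, l t * V ω t : ℝ) * Complex.I) ∂μ) atTop
      (𝓝 (∫ ω, Complex.exp ((∑ i, w i * Z ω i + ∑ t, l t * V ω t : ℝ) * Complex.I) ∂μ)))
    (f : BoundedContinuousFunction (ι → ℝ) ℝ) (g : BoundedContinuousFunction (κ → ℝ) ℝ) :
    Tendsto (fun n ↦ ∫ ω, f (Y n ω) * g (V ω) ∂μ) atTop (𝓝 (∫ ω, f (Z ω) * g (V ω) ∂μ)) := by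
  let J (U : Ω → ι → ℝ) (ω : Ω) : EuclideanSpace ℝ (ι ⊕ κ) :=
    WithLp.toLp 2 (Sum.elim (U ω) (V ω))
  have hJ {U : Ω → ι → ℝ} (hU : AEMeasurable U μ) : AEMeasurable (J U) μ := by
    refine (WithLp.measurable_toLp 2 _).comp_aemeasurable (aemeasurable_pi_lambda _ ?_)
    rintro (i | t)
    · exact (measurable_pi_apply i).comp_aemeasurable hU
    · exact (measurable_pi_apply t).comp_aemeasurable hV
  have hchar {U : Ω → ι → ℝ} (hU : AEMeasurable U μ) (x : EuclideanSpace ℝ (ι ⊕ κ)) :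
      charFun (μ.map (J U)) x = ∫ ω, Complex.exp ((∑ i, x (.inl i) * U ω i +
        ∑ t, x (.inr t) * V ω t : ℝ) * Complex.I) ∂μ := by
    rw [charFun_apply, integral_map (hJ hU) (by fun_prop)]
    simp [J, PiLp.inner_apply]
  let P (U : Ω → ι → ℝ) (hU : AEMeasurable U μ) : ProbabilityMeasure (EuclideanSpace ℝ (ι ⊕ κ)) :=
    ⟨μ.map (J U), Measure.isProbabilityMeasure_map (hJ hU)⟩
  have hP : Tendsto (fun n ↦ P (Y n) (hY n)) atTop (𝓝 (P Z hZ)) := by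
    refine ProbabilityMeasure.tendsto_of_tendsto_charFun fun x ↦ ?_
    simp only [P, ProbabilityMeasure.coe_mk, hchar (hY _), hchar hZ]
    exact h _ _
  let F : BoundedContinuousFunction (EuclideanSpace ℝ (ι ⊕ κ)) ℝ :=
    f.compContinuous ⟨fun x i ↦ x (.inl i), by fun_prop⟩ *
      g.compContinuous ⟨fun x t ↦ x (.inr t), by fun_prop⟩
  have hF {U : Ω → ι → ℝ} (hU : AEMeasurable U μ) :
      ∫ x, F x ∂(P U hU : Measure (EuclideanSpace ℝ (ι ⊕ κ))) = ∫ ω, f (U ω) * g (V ω) ∂μ :=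
    integral_map (hJ hU) F.continuous.measurable.aestronglyMeasurable
  have := ProbabilityMeasure.tendsto_iff_forall_integral_tendsto.1 hP F
  simpa only [hF] using this

lemma integral_cexp_sum_standardGaussian {Ω ι : Type*} [Fintype ι]
    [MeasurableSpace Ω] {μ : Measure Ω} [IsProbabilityMeasure μ] {ζ : ι → Ω → ℝ}
    (hζ : ∀ i, HasLaw (ζ i) (gaussianReal 0 1) μ) (hind : iIndepFun ζ μ) (w : ι → ℝ) :
    ∫ ω, Complex.exp ((∑ i, w i * ζ i ω : ℝ) * Complex.I) ∂μ =
      (Real.exp (-((∑ i, w i ^ 2) / 2)) : ℂ) := by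
  have hm i : AEMeasurable (fun ω ↦ w i * ζ i ω) μ := (hζ i).aemeasurable.const_mul _
  have h1 := congr_fun ((hind.comp (fun i x ↦ w i * x) fun i ↦
    measurable_const_mul _).charFun_map_fun_sum_eq_prod fun i ↦ hm i) 1
  rw [charFun_apply_real, integral_map (Finset.aemeasurable_fun_sum _ fun i _ ↦ hm i)
    (by fun_prop), Finset.prod_apply] at h1
  have h2 i : charFun (μ.map ((fun x ↦ w i * x) ∘ ζ i)) 1 =
      (Real.exp (-(w i ^ 2 / 2)) : ℂ) := by
    have := charFun_map_mul_comp (hζ i).aemeasurable (w i) 1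
    rw [Function.comp_def, this, (hζ i).map_eq, charFun_gaussianReal]
    push_cast
    simp
  rw [Finset.sum_div, ← Finset.sum_neg_distrib, Real.exp_sum, Complex.ofReal_prod,
    ← Finset.prod_congr rfl fun i _ ↦ h2 i]
  simpa [Function.comp_def] using h1

section Main

variable {Ω : Type*} {X B : ℝ → Ω → ℝ}

/-- At level `0` the grid is the integers, so the laws and independence needed for the limit come
from the lemmas on rescaled increments. -/
lemma unitIncrement_eq_rescaledIncrement (B : ℝ → Ω → ℝ) :
    unitIncrement B = rescaledIncrement B 0 := by
  ext i ω
  simp [unitIncrement, rescaledIncrement, rescaledProcess]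

variable [MeasurableSpace Ω] {μ : Measure Ω}

lemma aemeasurable_blockVector (hX : IsPreBrownianReal (fun t : ℝ≥0 ↦ X t) μ)
    (p : Polynomial ℝ) (α β : ℝ) (N n : ℕ) : AEMeasurable (blockVector X p α β N n) μ := by
  refine aemeasurable_pi_lambda _ fun k ↦ ?_
  refine Fin.addCases (fun j ↦ ?_) (fun j ↦ ?_) k
  · simpa only [blockVector, Fin.append_left] using aemeasurable_polyBlockSum hX p α β n j
  · simpa only [blockVector, Fin.append_right] using aemeasurable_signedBlockSum hX n j

lemma aemeasurable_limitVector (hB : IsPreBrownianReal (fun t : ℝ≥0 ↦ B t) μ)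
    (p : Polynomial ℝ) (α β : ℝ) (N : ℕ) : AEMeasurable (limitVector B p α β N) μ := by
  refine aemeasurable_pi_lambda _ fun k ↦ ?_
  refine Fin.addCases (fun j ↦ ?_) (fun j ↦ ?_) k
  · simpa only [limitVector, Fin.append_left, unitIncrement_eq_rescaledIncrement] using
      (aemeasurable_rescaledIncrement hB 0 j).const_mul _
  · simpa only [limitVector, Fin.append_right, unitIncrement_eq_rescaledIncrement] using
      aemeasurable_rescaledIncrement hB 0 (N + j)

lemma integral_cexp_limitVector_add {κ : Type*} [Fintype κ]
    (hB : IsPreBrownianReal (fun t : ℝ≥0 ↦ B t) μ)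
    (hX : IsPreBrownianReal (fun t : ℝ≥0 ↦ X t) μ)
    (hXB : IndepFun (fun ω t ↦ X t ω) (fun ω t ↦ B t ω) μ)
    (p : Polynomial ℝ) (α β : ℝ) (N : ℕ) (w : Fin (N + N) → ℝ) (l : κ → ℝ) (τ : κ → ℝ≥0) :
    ∫ ω, Complex.exp ((∑ k, w k * limitVector B p α β N ω k + ∑ t, l t * X (τ t) ω : ℝ) *
      Complex.I) ∂μ =
      (∫ ω, Complex.exp ((∑ t, l t * X (τ t) ω : ℝ) * Complex.I) ∂μ) *
      ∫ ω, Complex.exp ((∑ k, w k * limitVector B p α β N ω k : ℝ) * Complex.I) ∂μ := by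
  have hXm : AEMeasurable (fun ω ↦ ∑ t, l t * X (τ t) ω) μ :=
    Finset.aemeasurable_fun_sum _ fun t _ ↦ (hX.aemeasurable (τ t)).const_mul _
  have hBm : AEMeasurable (fun ω ↦ ∑ k, w k * limitVector B p α β N ω k) μ :=
    Finset.aemeasurable_fun_sum _ fun k _ ↦
      ((measurable_pi_apply k).comp_aemeasurable
        (aemeasurable_limitVector hB p α β N)).const_mul _
  have hφ : Measurable fun x : ℝ → ℝ ↦
      Complex.exp ((∑ t, l t * x (τ t) : ℝ) * Complex.I) := by fun_prop
  -- `limitVector` is evaluated on the coordinate process of `ℝ → ℝ`, so that composing with the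
  -- path of `B` recovers the actual factor.
  have hψ : Measurable fun b : ℝ → ℝ ↦ Complex.exp
      ((∑ k, w k * limitVector (fun t b ↦ b t) p α β N b k : ℝ) * Complex.I) := by
    have hl k : Measurable fun b : ℝ → ℝ ↦ limitVector (fun t b ↦ b t) p α β N b k := by
      refine Fin.addCases (fun j ↦ ?_) (fun j ↦ ?_) k <;>
        simp only [limitVector, Fin.append_left, Fin.append_right, unitIncrement] <;> fun_prop
    fun_prop
  have hind := hXB.comp hφ hψ
  have h := hind.integral_fun_mul_eq_mul_integral
    (AEMeasurable.aestronglyMeasurable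
      (f := fun ω ↦ Complex.exp ((∑ t, l t * X (τ t) ω : ℝ) * Complex.I)) (by fun_prop))
    (AEMeasurable.aestronglyMeasurable
      (f := fun ω ↦ Complex.exp ((∑ k, w k * limitVector B p α β N ω k : ℝ) * Complex.I))
      (by fun_prop))
  refine Eq.trans ?_ h
  congr with ω
  rw [add_comm, Complex.ofReal_add, add_mul, Complex.exp_add]
  rfl

variable [IsProbabilityMeasure μ]

lemma integral_cexp_limitVector (hB : IsPreBrownianReal (fun t : ℝ≥0 ↦ B t) μ)
    (p : Polynomial ℝ) (α β : ℝ) (N : ℕ) (w : Fin (N + N) → ℝ) :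
    ∫ ω, Complex.exp ((∑ k, w k * limitVector B p α β N ω k : ℝ) * Complex.I) ∂μ =
      (Real.exp (-((∑ j : Fin N, w (j.castAdd N) ^ 2 * gaussianVar p * ((α ^ 2 + β ^ 2) / 2) +
        ∑ j : Fin N, w (j.natAdd N) ^ 2) / 2)) : ℂ) := by
  set σ := √((α ^ 2 + β ^ 2) / 2 * gaussianVar p) with hσ
  have hσ2 : σ ^ 2 = (α ^ 2 + β ^ 2) / 2 * gaussianVar p :=
    Real.sq_sqrt (mul_nonneg (by positivity) (variance_nonneg _ _))
  -- Both halves of the limit vector use increment `k + 1` at position `k`, so its coordinates are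
  -- scaled distinct increments of `B`.
  have hind : iIndepFun (fun k : Fin (N + N) ↦ rescaledIncrement B 0 (k + 1)) μ :=
    (iIndepFun_rescaledIncrement hB 0).precomp Fin.val_injective
  have h := integral_cexp_sum_standardGaussian
    (fun k : Fin (N + N) ↦ hasLaw_rescaledIncrement hB 0 k) hind
    (Fin.append (fun j ↦ σ * w (j.castAdd N)) fun j ↦ w (j.natAdd N))
  simp only [Fin.sum_univ_add, Fin.append_left, Fin.append_right, Fin.val_castAdd,
    Fin.val_natAdd, mul_pow, hσ2] at h
  simp only [Fin.sum_univ_add, limitVector, Fin.append_left, Fin.append_right,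
    unitIncrement_eq_rescaledIncrement, ← hσ]
  have h1 ω : ∑ j : Fin N, w (j.castAdd N) * (σ * rescaledIncrement B 0 (j + 1) ω) =
      ∑ j : Fin N, σ * w (j.castAdd N) * rescaledIncrement B 0 (j + 1) ω :=
    Finset.sum_congr rfl fun j _ ↦ by ring
  have h2 : ∑ j : Fin N, w (j.castAdd N) ^ 2 * gaussianVar p * ((α ^ 2 + β ^ 2) / 2) =
      ∑ j : Fin N, (α ^ 2 + β ^ 2) / 2 * gaussianVar p * w (j.castAdd N) ^ 2 :=
    Finset.sum_congr rfl fun j _ ↦ by ring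
  simp_rw [h1]
  rw [h, h2]

/-- Passing from grid points to the exact times `τ t` changes the exponent by `R n`, which tends to
`0` almost surely. As the exponentials have modulus one, dominated convergence removes it. -/
lemma tendsto_integral_cexp_blockVector_add {κ : Type*} [Fintype κ]
    (hX : IsBrownianReal (fun t : ℝ≥0 ↦ X t) μ)
    {p : Polynomial ℝ} (hp : CenteredHermiteRankGeTwo p) (α β : ℝ) (N : ℕ)
    (w : Fin (N + N) → ℝ) (l : κ → ℝ) (τ : κ → ℝ≥0) :
    Tendsto (fun n ↦ ∫ ω, Complex.exp ((∑ k, w k * blockVector X p α β N n ω k +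
      ∑ t, l t * X (τ t) ω : ℝ) * Complex.I) ∂μ) atTop
      (𝓝 ((∫ ω, Complex.exp ((∑ t, l t * X (τ t) ω : ℝ) * Complex.I) ∂μ) *
        (Real.exp (-((∑ j : Fin N, w (j.castAdd N) ^ 2 * gaussianVar p * ((α ^ 2 + β ^ 2) / 2) +
          ∑ j : Fin N, w (j.natAdd N) ^ 2) / 2)) : ℂ))) := by
  have hX' := hX.toIsPreBrownianReal
  let u : Fin N → ℝ := fun j ↦ w (j.castAdd N)
  let v : Fin N → ℝ := fun j ↦ w (j.natAdd N)
  have hXm : AEMeasurable (fun ω ↦ ∑ t, l t * X (τ t) ω) μ :=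
    Finset.aemeasurable_fun_sum _ fun t _ ↦ (hX.aemeasurable (τ t)).const_mul _
  have hm n := aemeasurable_gridCombination hX' p α β u v l τ n
  have hm0 n := aemeasurable_gridCombination hX' p α β (0 : Fin N → ℝ) 0 l τ n
  let R : ℕ → Ω → ℝ := fun n ω ↦
    ∑ t, l t * X (τ t) ω - gridCombination X p α β (0 : Fin N → ℝ) 0 l τ n ω
  have hR n : AEMeasurable (R n) μ := hXm.sub (hm0 n)
  have hsum n ω : ∑ k, w k * blockVector X p α β N n ω k + ∑ t, l t * X (τ t) ω =
      gridCombination X p α β u v l τ n ω + R n ω := by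
    simp only [R, gridCombination, blockVector, Fin.sum_univ_add, Fin.append_left,
      Fin.append_right, Pi.zero_apply, zero_mul, Finset.sum_const_zero, u, v]
    ring
  have hc : Continuous fun x : ℝ ↦ Complex.exp (x * Complex.I) := by fun_prop
  have hdiff : Tendsto (fun n ↦ ∫ ω,
      Complex.exp (gridCombination X p α β u v l τ n ω * Complex.I) *
        (Complex.exp (R n ω * Complex.I) - 1) ∂μ) atTop (𝓝 0) := by
    have h0 : ∫ _, (0 : ℂ) ∂μ = 0 := integral_zero _ _
    rw [← h0]
    refine tendsto_integral_of_dominated_convergence (fun _ ↦ 2) (fun n ↦ ?_)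
      (integrable_const _) (fun n ↦ .of_forall fun ω ↦ ?_) ?_
    · have := hm n
      have := hR n
      exact AEMeasurable.aestronglyMeasurable (by fun_prop)
    · rw [norm_mul, Complex.norm_exp_ofReal_mul_I, one_mul]
      refine (norm_sub_le _ _).trans ?_
      rw [Complex.norm_exp_ofReal_mul_I, norm_one]
      norm_num
    · filter_upwards [hX.cont, hX.eval_zero_ae_eq_zero] with ω hω hω0
      have h1 : Tendsto (fun n ↦ R n ω) atTop (𝓝 0) := by
        have := (tendsto_const_nhds (x := ∑ t, l t * X (τ t) ω)).sub
          (tendsto_gridCombination_zero (N := N) hω (by simpa using hω0) p α β l τ)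
        simpa using this
      have h2 := ((hc.tendsto 0).comp h1).sub_const 1
      simp only [Complex.ofReal_zero, zero_mul, Complex.exp_zero, sub_self] at h2
      rw [tendsto_zero_iff_norm_tendsto_zero] at h2 ⊢
      refine h2.congr fun n ↦ ?_
      rw [norm_mul, Complex.norm_exp_ofReal_mul_I, one_mul]
      rfl
  have h := (tendsto_integral_cexp_gridCombination hX hp α β u v l τ).add hdiff
  rw [add_zero] at h
  refine h.congr fun n ↦ ?_
  have hint {U : Ω → ℝ} (hU : AEMeasurable U μ) :
      Integrable (fun ω ↦ Complex.exp (U ω * Complex.I)) μ :=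
    .of_bound (AEMeasurable.aestronglyMeasurable (by fun_prop)) 1
      (.of_forall fun ω ↦ (Complex.norm_exp_ofReal_mul_I _).le)
  have hmul ω : Complex.exp (gridCombination X p α β u v l τ n ω * Complex.I) *
      (Complex.exp (R n ω * Complex.I) - 1) =
      Complex.exp ((gridCombination X p α β u v l τ n ω + R n ω : ℝ) * Complex.I) -
        Complex.exp (gridCombination X p α β u v l τ n ω * Complex.I) := by
    rw [mul_sub, mul_one, ← Complex.exp_add]
    push_cast
    ring_nf
  simp_rw [hmul, hsum]
  have hadd : AEMeasurable (fun ω ↦ gridCombination X p α β u v l τ n ω + R n ω) μ :=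
    (hm n).add (hR n)
  rw [integral_sub (hint hadd) (hint (hm n)), add_sub_cancel]

end Main

theorem mainTheorem5 {Ω : Type*} [MeasurableSpace Ω] (μ : Measure Ω) [IsProbabilityMeasure μ]
    (X B : ℝ → Ω → ℝ)
    (hX : IsTwoSidedBrownianMotion X μ) (hB : IsTwoSidedBrownianMotion B μ)
    (hXB : IndepFun (fun ω t ↦ X t ω) (fun ω t ↦ B t ω) μ)
    (p : Polynomial ℝ) (hp : CenteredHermiteRankGeTwo p)
    (α β : ℝ) (N : ℕ) (hN : 1 ≤ N) :
    TendstoInDistribution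
      (fun (n : ℕ) ω ↦ (blockVector X p α β N n ω, rightPath X ω)) atTop
      (fun ω ↦ (limitVector B p α β N ω, rightPath X ω)) (fun _ ↦ μ) μ := by
  have hX' := hX.right.toIsPreBrownianReal
  have hB' := hB.right.toIsPreBrownianReal
  refine tendstoInDistribution_prodMk_contPath (aemeasurable_blockVector hX' p α β N)
    (aemeasurable_limitVector hB' p α β N) (aemeasurable_rightPath hX.right) fun I f g ↦ ?_
  have hpath (U : Ω → Fin (N + N) → ℝ) :
      ∫ ω, f (U ω) * g (fun t ↦ rightPath X ω t) ∂μ =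
        ∫ ω, f (U ω) * g (fun t : I ↦ X (t : ℝ≥0) ω) ∂μ := by
    refine integral_congr_ae ?_
    filter_upwards [ae_rightPath_apply hX.right.cont] with ω hω
    simp only [hω]
  simp_rw [hpath]
  refine tendsto_integral_mul_of_tendsto_integral_cexp (κ := I) (V := fun ω t ↦ X (t : ℝ≥0) ω)
    (aemeasurable_blockVector hX' p α β N) (aemeasurable_limitVector hB' p α β N)
    (aemeasurable_pi_lambda _ fun t ↦ hX'.aemeasurable (t : ℝ≥0)) (fun w l ↦ ?_) f g
  rw [integral_cexp_limitVector_add hB' hX' hXB p α β N w l (fun t : I ↦ (t : ℝ≥0)),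
    integral_cexp_limitVector hB']
  exact tendsto_integral_cexp_blockVector_add hX.right hp α β N w l fun t : I ↦ (t : ℝ≥0)
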